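/- Let $d=-A^{-2}-A^{2}$. For a virtual link diagram $D$ let $\langle D\rangle=\sum_{s}A^{c(s)}d^{|s|-1}\in\mathbb Z[A,A^{-1}]$ be its bracket polynomial, where $s$ runs over all choices of a smoothing of type $\alpha$ or $\beta$ at each classical crossing, $c(s)$ is the number of $\alpha$-smoothings minus the number of $\beta$-smoothings, and $|s|$ is the number of closed curves after smoothing (virtual crossings are kept). An $\alpha$-smoothing joins the two regions swept out by the overstrand when it is turned counterclockwise. For a virtual knot diagram $K$ let $\langle K\rangle_N$ be the bracket polynomial of the diagram formed by $N$ parallel copies of $K$ in the plane, in which each classical (virtual) crossing of $K$ is replaced by an $N\times N$ grid of classical (virtual) crossings of the same kind. Two virtual knot diagrams are equivalent if they are related by planar isotopy, the classical Reidemeister moves I, II, III and the virtual Reidemeister moves I, II, III, IV (the last one moves a strand with virtual crossings across a classical crossing). Let $K_m$ be the virtual knot diagram in the plane with classical crossings $1,\dots,6$ and virtual crossings $7,8$ that is traversed in the order $$U1^+\;O2^+\;V7\;O1^+\;O3^-\;U4^-\;U2^+\;V7\;O4^-\;U3^-\;U5^-\;V8\;O6^+\;O5^-\;V8\;U6^+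 ,$$ where $O$, $U$, $V$ stand for an over-, under- and virtual passage and the exponent is the sign of the crossing (the plane diagram with these two virtual crossings is fixed on the sphere by this data). Let $\bigcirc$ be the unknot diagram, the round circle without crossings. Then: 1. $\langle K_m\rangle=1=\langle \bigcirc\rangle$ and $\langle K_m\rangle_2=d=\langle \bigcirc\rangle_2$, so $K_m$ is not detected by the bracket polynomial or the 2-strand bracket polynomial. 2. $K_m$ is detected by the 3-strand bracket polynomial: $\langle \bigcirc\rangle_3=d^2$, but $\langle K_m\rangle_3\ne\langle \bigcirc\rangle_3$, namely $$\begin{aligned}\langle K_m\rangle_3={}&-A^{-60}+A^{-56}+2A^{-54}+5A^{-52}+10A^{-50}+21A^{-48}+25A^{-46}+26A^{-44}\\ &+21A^{-42}+8A^{-40}-19A^{-38}-69A^{-36}-115A^{-34}-155A^{-32}-175A^{-30}-172A^{-28}\\ &-127A^{-26}-23A^{-24}+109A^{-22}+244A^{-20}+366A^{-18}+440A^{-16}+452A^{-14}+372A^{-12}\\ &+207A^{-10}+23A^{-8}-199A^{-6}-358A^{-4}-486A^{-2}-527-460A^{2}-364A^{4}\\ &-187A^{6}-58A^{8}+96A^{10}+208A^{12}+250A^{14}+269A^{16}+222A^{18}+200A^{20}\\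 &+131A^{22}+71A^{24}+21A^{26}-15A^{28}-29A^{30}-54A^{32}-51A^{34}-48A^{36}\\ &-36A^{38}-28A^{40}-22A^{42}-10A^{44}-6A^{46}-2A^{48}-A^{50}+A^{54}.\end{aligned}$$ 3. $K_m$ is non-trivial: it is not equivalent to the unknot. -/

import Mathlib

namespace VirtualKnotTheory

/-! ### Diagrams

A diagram is recorded by its vertices. Each edge with label `e` has the two ends `(e, true)` and
`(e, false)`, and a vertex lists the ends that meet there in counterclockwise order in the plane. -/

/-- One of the two ends of the edge with label `h.1`. -/
abbrev HalfEdge (L : Type) : Type := L × Bool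

/-- The other end of the same edge. -/
def HalfEdge.flip {L : Type} (h : HalfEdge L) : HalfEdge L := (h.1, !h.2)

/-- The vertices of a diagram, with the ends at the vertex in counterclockwise order.
`classical a b c d`: the strand from `a` to `c` passes under the strand from `b` to `d`.
`virtual a b c d`: the strand from `a` to `c` and the strand from `b` to `d` cross virtually.
`point a b`: a marked point in the interior of a strand, where `a` and `b` meet (no crossing);
a marked point makes it possible to draw a circle without crossings. -/
inductive Vertex (L : Type) : Type
  | classical (a b c d : HalfEdge L)
  | virtual (a b c d : HalfEdge L)
  | point (a b : HalfEdge L)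

/-- A virtual link diagram, as the list of its vertices. -/
abbrev Diagram (L : Type) : Type := List (Vertex L)

/-- The ends at a vertex, counterclockwise. -/
def Vertex.ends {L : Type} : Vertex L → List (HalfEdge L)
  | .classical a b c d => [a, b, c, d]
  | .virtual a b c d => [a, b, c, d]
  | .point a b => [a, b]

/-- Rename the ends at a vertex. -/
def Vertex.map {L M : Type} (f : HalfEdge L → HalfEdge M) : Vertex L → Vertex M
  | .classical a b c d => .classical (f a) (f b) (f c) (f d)
  | .virtual a b c d => .virtual (f a) (f b) (f c) (f d)
  | .point a b => .point (f a) (f b)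

/-- The pairs of ends that are joined when one walks straight through a vertex. -/
def Vertex.strands {L : Type} : Vertex L → List (HalfEdge L × HalfEdge L)
  | .classical a b c d => [(a, c), (b, d)]
  | .virtual a b c d => [(a, c), (b, d)]
  | .point a b => [(a, b)]

/-- All ends of all vertices of a diagram. -/
def ends {L : Type} (D : Diagram L) : List (HalfEdge L) := D.flatMap Vertex.ends

/-- The number of classes of the equivalence relation generated by a list of pairs, on the
elements that occur in the list. -/
noncomputable def numClasses {α : Type} (l : List (α × α)) : ℕ :=
  (Quot.mk (fun x y => (x, y) ∈ l) '' {x | ∃ p ∈ l, x = p.1 ∨ x = p.2}).ncard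

/-- The number of closed curves that arise when the ends of the edges are joined as listed: two
edges lie on the same curve if they are connected by a chain of joins. -/
noncomputable def numCurves {L : Type} (joins : List (HalfEdge L × HalfEdge L)) : ℕ :=
  numClasses (joins.map fun p => (p.1.1, p.2.1))

/-- The number of components of the link that a diagram shows. -/
noncomputable def numComponents {L : Type} (D : Diagram L) : ℕ :=
  numCurves (D.flatMap Vertex.strands)

/-- Pairs `(p, q.flip)`, where `q` is the counterclockwise successor of `p` at the vertex. If `p`
stands for the corner between `p` and `q`, the two entries are consecutive corners of a face. -/
def Vertex.corners {L : Type} : Vertex L → List (HalfEdge L × HalfEdge L)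
  | .classical a b c d => [(a, b.flip), (b, c.flip), (c, d.flip), (d, a.flip)]
  | .virtual a b c d => [(a, b.flip), (b, c.flip), (c, d.flip), (d, a.flip)]
  | .point a b => [(a, b.flip), (b, a.flip)]

/-- The number of faces of a diagram (its complementary regions, if it is connected). -/
noncomputable def numFaces {L : Type} (D : Diagram L) : ℕ :=
  numClasses (D.flatMap Vertex.corners)

/-- The vertex list describes an immersed circle in the plane with classical and virtual crossings:
the ends of the edges are used exactly once each, walking along the strands there is only one
component, and the diagram is planar, `V - E + F = 2`. -/
structure IsVirtualKnotDiagram {L : Type} (D : Diagram L) : Prop where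
  nodup : (ends D).Nodup
  flip_mem : ∀ h ∈ ends D, h.flip ∈ ends D
  one_component : numComponents D = 1
  planar : D.length + numFaces D = (ends D).length / 2 + 2

/-- A virtual knot diagram in the plane. -/
structure VirtualKnotDiagram : Type where
  vertices : Diagram ℕ
  isDiagram : IsVirtualKnotDiagram vertices

/-! ### Reidemeister moves and virtual equivalence -/

/-- The local moves: the first tangle is replaced by the second one. The ends `a, b, c, ...` lead
out of the tangle, the edges `x, y, z` lie inside. -/
inductive LocalMove : Diagram ℕ → Diagram ℕ → Prop
  -- The presentation of a vertex: the ends may be listed from any starting point.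
  | rotateClassical (a b c d : HalfEdge ℕ) :
      LocalMove [.classical a b c d] [.classical c d a b]
  | rotateVirtual (a b c d : HalfEdge ℕ) :
      LocalMove [.virtual a b c d] [.virtual b c d a]
  | rotatePoint (a b : HalfEdge ℕ) : LocalMove [.point a b] [.point b a]
  -- A marked point is inserted on the edge with end `a` at the vertex `v`.
  | subdivide (v : Vertex ℕ) (a : HalfEdge ℕ) (x : ℕ) (ha : a ∈ v.ends) :
      LocalMove [v] [v.map (fun h => if h = a then (x, true) else h), .point (x, false) a]
  -- Reidemeister I, for the two kinds of kinks.
  | reidemeister1 (a b : HalfEdge ℕ) (x : ℕ) :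
      LocalMove [.classical (x, true) (x, false) a b] [.point a b]
  | reidemeister1' (a b : HalfEdge ℕ) (x : ℕ) :
      LocalMove [.classical a (x, true) (x, false) b] [.point a b]
  -- Reidemeister II: the strand `c`-`d` passes over the strand `a`-`b` and back.
  | reidemeister2 (a b c d : HalfEdge ℕ) (x y : ℕ) :
      LocalMove [.classical a c (x, true) (y, true), .classical (x, false) d b (y, false)]
        [.point a b, .point c d]
  -- Reidemeister III: the strand `f`-`c` passes over the crossing of `a`-`d` and `b`-`e`
  -- (the ends of the tangle are `a, b, c, d, e, f` in counterclockwise order).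
  | reidemeister3 (a b c d e f : HalfEdge ℕ) (x y z : ℕ) :
      LocalMove
        [.classical a (y, true) (x, true) f, .classical b c (z, true) (y, false),
          .classical (x, false) (z, false) d e]
        [.classical a b (x, true) (z, true), .classical (z, false) (y, true) e f,
          .classical (x, false) c d (y, false)]
  | reidemeister3' (a b c d e f : HalfEdge ℕ) (x y z : ℕ) :
      LocalMove
        [.classical a (y, true) (x, true) f, .classical b c (z, true) (y, false),
          .classical (z, false) d e (x, false)]
        [.classical b (x, true) (z, true) a, .classical (z, false) (y, true) e f,
          .classical (x, false) c d (y, false)]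
  -- Virtual Reidemeister moves I, II and III: all crossings are virtual.
  | virtual1 (a b : HalfEdge ℕ) (x : ℕ) :
      LocalMove [.virtual (x, true) (x, false) a b] [.point a b]
  | virtual2 (a b c d : HalfEdge ℕ) (x y : ℕ) :
      LocalMove [.virtual a c (x, true) (y, true), .virtual (x, false) d b (y, false)]
        [.point a b, .point c d]
  | virtual3 (a b c d e f : HalfEdge ℕ) (x y z : ℕ) :
      LocalMove
        [.virtual a (y, true) (x, true) f, .virtual b c (z, true) (y, false),
          .virtual (x, false) (z, false) d e]
        [.virtual a b (x, true) (z, true), .virtual (z, false) (y, true) e f,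
          .virtual (x, false) c d (y, false)]
  -- Virtual Reidemeister move IV: the strand `f`-`c` passes virtually across a classical crossing.
  | virtual4 (a b c d e f : HalfEdge ℕ) (x y z : ℕ) :
      LocalMove
        [.virtual a (y, true) (x, true) f, .virtual b c (z, true) (y, false),
          .classical (x, false) (z, false) d e]
        [.classical a b (x, true) (z, true), .virtual (z, false) (y, true) e f,
          .virtual (x, false) c d (y, false)]
  | virtual4' (a b c d e f : HalfEdge ℕ) (x y z : ℕ) :
      LocalMove
        [.virtual a (y, true) (x, true) f, .virtual b c (z, true) (y, false),
          .classical (z, false) d e (x, false)]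
        [.classical b (x, true) (z, true) a, .virtual (z, false) (y, true) e f,
          .virtual (x, false) c d (y, false)]

/-- One step between vertex lists: reorder the list, rename the edges, or apply a local move. -/
inductive Step : Diagram ℕ → Diagram ℕ → Prop
  | perm {D D' : Diagram ℕ} (h : D.Perm D') : Step D D'
  | rename (D : Diagram ℕ) (f : Equiv.Perm (HalfEdge ℕ)) (hf : ∀ h, f h.flip = (f h).flip) :
      Step D (D.map (Vertex.map f))
  | move {T T' : Diagram ℕ} (h : LocalMove T T') (rest : Diagram ℕ) : Step (T ++ rest) (T' ++ rest)

/-- Virtual equivalence: a sequence of moves, or of their inverses, through virtual knot diagrams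
in the plane leads from one diagram to the other. -/
def VirtuallyEquivalent : VirtualKnotDiagram → VirtualKnotDiagram → Prop :=
  Relation.EqvGen fun K K' => Step K.vertices K'.vertices

/-! ### The bracket polynomial -/

/-- A smoothing of all classical crossings of a diagram: `c` is the number of smoothings of type
`α` minus the number of smoothings of type `β`, and `joins` lists the ends that are joined. -/
structure State (L : Type) : Type where
  c : ℤ
  joins : List (HalfEdge L × HalfEdge L)

/-- All states of a diagram; a diagram with `n` classical crossings has `2 ^ n` states. The smoothing
of type `α` of `classical a b c d` opens the two regions that the overstrand `b`-`d` sweeps out when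
it is turned counterclockwise: it joins `a` to `b` and `c` to `d`. -/
def states {L : Type} : Diagram L → List (State L)
  | [] => [⟨0, []⟩]
  | .classical a b c d :: D => (states D).flatMap fun s =>
      [⟨s.c + 1, (a, b) :: (c, d) :: s.joins⟩, ⟨s.c - 1, (a, d) :: (b, c) :: s.joins⟩]
  | .virtual a b c d :: D => (states D).map fun s => ⟨s.c, (a, c) :: (b, d) :: s.joins⟩
  | .point a b :: D => (states D).map fun s => ⟨s.c, (a, b) :: s.joins⟩

open LaurentPolynomial in
/-- The loop value `d = -A ^ (-2) - A ^ 2`, where `A` is `T 1`. -/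
noncomputable def d : LaurentPolynomial ℤ := -T (-2) - T 2

open LaurentPolynomial in
/-- The bracket polynomial: the sum over all states `s` of `A ^ c(s) * d ^ (|s| - 1)`, where `|s|` is
the number of closed curves of `s`. -/
noncomputable def bracket {L : Type} (D : Diagram L) : LaurentPolynomial ℤ :=
  ((states D).map fun s => T s.c * d ^ (numCurves s.joins - 1)).sum

/-! ### The `N`-strand bracket polynomial -/

/-- Labels for the edges of the diagram formed by `N` parallel copies: the copies of an old edge, and
the edges in the grid of `N * N` crossings that replaces a crossing. A grid is identified by the
first end `g` of the old crossing. -/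
inductive CableLabel (L : Type) : Type
  | strand (e : L) (m : ℕ)
  | vertical (g : HalfEdge L) (i j : ℕ)
  | horizontal (g : HalfEdge L) (i j : ℕ)

/-- The ends of the `N` copies of an edge are numbered `0, ..., N - 1` counterclockwise around the
vertex where they arrive. Parallel copies appear in opposite orders at the two ends of an edge. -/
def copy {L : Type} (N : ℕ) (h : HalfEdge L) (m : ℕ) : HalfEdge (CableLabel L) :=
  (.strand h.1 (if h.2 then m else N - 1 - m), h.2)

/-- The grid of `N * N` crossings that replaces a crossing with ends `a` (bottom), `b` (right),
`c` (top), `e` (left). The crossing in column `i` (from the left) and row `j` (from the bottom) has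
the ends bottom, right, top, left. -/
def grid {L : Type} (N : ℕ)
    (mk : HalfEdge (CableLabel L) → HalfEdge (CableLabel L) → HalfEdge (CableLabel L) →
      HalfEdge (CableLabel L) → Vertex (CableLabel L))
    (a b c e : HalfEdge L) : Diagram (CableLabel L) :=
  (List.range N).flatMap fun i => (List.range N).map fun j =>
    mk (if j = 0 then copy N a i else (.vertical a i j, false))
      (if i + 1 = N then copy N b j else (.horizontal a (i + 1) j, true))
      (if j + 1 = N then copy N c (N - 1 - i) else (.vertical a i (j + 1), true))
      (if i = 0 then copy N e (N - 1 - j) else (.horizontal a i j, false))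

/-- The part of the `N`-strand diagram that replaces a vertex. -/
def cableVertex {L : Type} (N : ℕ) : Vertex L → Diagram (CableLabel L)
  | .classical a b c e => grid N .classical a b c e
  | .virtual a b c e => grid N .virtual a b c e
  | .point a b => (List.range N).map fun m => .point (copy N a m) (copy N b (N - 1 - m))

/-- The diagram formed by `N` parallel copies of a diagram. -/
def cable {L : Type} (N : ℕ) (D : Diagram L) : Diagram (CableLabel L) :=
  D.flatMap (cableVertex N)

/-- The bracket polynomial of a virtual knot diagram. -/
noncomputable def VirtualKnotDiagram.bracket (K : VirtualKnotDiagram) : LaurentPolynomial ℤ :=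
  VirtualKnotTheory.bracket K.vertices

/-- The `N`-strand bracket polynomial of a virtual knot diagram. -/
noncomputable def VirtualKnotDiagram.bracketN (K : VirtualKnotDiagram) (N : ℕ) :
    LaurentPolynomial ℤ :=
  VirtualKnotTheory.bracket (cable N K.vertices)

/-! ### The two diagrams -/

/-- A criterion to count classes: `par` moves each element along a listed pair or fixes it, and
iterating it `k` times has the same result on both entries of a pair. -/
theorem numClasses_eq {α : Type} [DecidableEq α] (l : List (α × α)) (par : α → α) (k n : ℕ)
    (h1 : ∀ p ∈ l, par^[k] p.1 = par^[k] p.2)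
    (h2 : ∀ x ∈ l.map Prod.fst ++ l.map Prod.snd, par x = x ∨ (x, par x) ∈ l ∨ (par x, x) ∈ l)
    (h3 : (((l.map Prod.fst ++ l.map Prod.snd).map par^[k]).dedup).length = n) :
    numClasses l = n := by
  have hS : {x | ∃ p ∈ l, x = p.1 ∨ x = p.2} = {x | x ∈ l.map Prod.fst ++ l.map Prod.snd} := by
    ext x
    simp only [Set.mem_ofPred_eq, List.mem_append, List.mem_map]
    constructor
    · rintro ⟨p, hp, h | h⟩
      · exact Or.inl ⟨p, hp, h.symm⟩
      · exact Or.inr ⟨p, hp, h.symm⟩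
    · rintro (⟨p, hp, h⟩ | ⟨p, hp, h⟩)
      · exact ⟨p, hp, Or.inl h.symm⟩
      · exact ⟨p, hp, Or.inr h.symm⟩
  have hpar : ∀ x ∈ l.map Prod.fst ++ l.map Prod.snd,
      par x ∈ l.map Prod.fst ++ l.map Prod.snd ∧
        Quot.mk (fun x y => (x, y) ∈ l) (par x) = Quot.mk (fun x y => (x, y) ∈ l) x := by
    intro x hx
    rcases h2 x hx with h | h | h
    · rw [h]; exact ⟨hx, rfl⟩
    · exact ⟨List.mem_append_right _ (List.mem_map.2 ⟨_, h, rfl⟩), (Quot.sound h).symm⟩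
    · exact ⟨List.mem_append_left _ (List.mem_map.2 ⟨_, h, rfl⟩), Quot.sound h⟩
  have hit : ∀ m : ℕ, ∀ x ∈ l.map Prod.fst ++ l.map Prod.snd,
      Quot.mk (fun x y => (x, y) ∈ l) (par^[m] x) = Quot.mk (fun x y => (x, y) ∈ l) x := by
    intro m
    induction m with
    | zero => intro x _; rfl
    | succ m ih =>
      intro x hx
      rw [Function.iterate_succ_apply, ih _ (hpar x hx).1, (hpar x hx).2]
  let F : Quot (fun x y => (x, y) ∈ l) → α := Quot.lift par^[k] (fun x y h => h1 (x, y) h)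
  have hinj : Set.InjOn F (Quot.mk (fun x y => (x, y) ∈ l) ''
      {x | x ∈ l.map Prod.fst ++ l.map Prod.snd}) := by
    rintro _ ⟨x, hx, rfl⟩ _ ⟨y, hy, rfl⟩ hxy
    have hxy' : par^[k] x = par^[k] y := hxy
    rw [← hit k x hx, ← hit k y hy, hxy']
  unfold numClasses
  rw [hS, ← hinj.ncard_image, Set.image_image, ← h3, ← List.card_toFinset,
    ← Set.ncard_coe_finset]
  congr 1
  ext z
  simp only [Set.mem_image, List.coe_toFinset, Set.mem_ofPred_eq, List.mem_map]
  rfl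

/-- The round circle: the standard diagram of the unknot. -/
def unknotVertices : Diagram ℕ := [.point (0, true) (0, false)]

/-- The vertices of `K_m`: six classical crossings and two virtual crossings. The edges are numbered
`0, ..., 15` along the knot, which runs from `(i, true)` to `(i, false)` on the edge `i`. With the
crossings numbered in the order of the list (7 and 8 are virtual, O is over, U is under, followed by
the sign), the knot runs through
U1+ O2+ V7 O1+ O3- U4- U2+ V7 O4- U3- U5- V8 O6+ O5- V8 U6+. -/
def kmVertices : Diagram ℕ :=
  [.classical (0, false) (4, true) (1, true) (3, false),
    .classical (6, false) (2, true) (7, true) (1, false),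
    .classical (9, false) (4, false) (10, true) (5, true),
    .classical (5, false) (8, false) (6, true) (9, true),
    .classical (10, false) (13, false) (11, true) (14, true),
    .classical (15, false) (13, true) (0, true) (12, false),
    .virtual (2, false) (8, true) (3, true) (7, false),
    .virtual (11, false) (15, true) (12, true) (14, false)]

/-- The unknot. -/
def unknot : VirtualKnotDiagram where
  vertices := unknotVertices
  isDiagram :=
    { nodup := by decide
      flip_mem := by decide
      one_component := numClasses_eq _ id 0 1 (by decide) (by decide) (by decide)
      planar := by
        have h : numFaces unknotVertices = 2 :=
          numClasses_eq _ id 0 2 (by decide) (by decide) (by decide)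
        rw [h]; rfl }

/-- A step along the face of `kmVertices`, which stops at a chosen corner of the face. -/
def kmFaceStep (h : HalfEdge ℕ) : HalfEdge ℕ :=
  if h ∈ [(0, false), (4, true), (1, true), (3, false), (6, false), (2, true), (5, true),
    (13, false), (11, true), (12, false)] then h
  else ((kmVertices.flatMap Vertex.corners).lookup h).getD h

/-- The virtual knot diagram `K_m`. -/
def Km : VirtualKnotDiagram where
  vertices := kmVertices
  isDiagram :=
    { nodup := by decide
      flip_mem := by decide
      one_component := numClasses_eq _ Nat.pred 15 1 (by decide) (by decide) (by decide)
      planar := by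
        have h : numFaces kmVertices = 10 :=
          numClasses_eq _ kmFaceStep 6 10 (by decide +kernel) (by decide +kernel)
            (by decide +kernel)
        rw [h]; rfl }

end VirtualKnotTheory

namespace VirtualKnotTheory

/-!
A state of a diagram is computed vertex by vertex: the arcs drawn so far form a pairing of their
ends, and each join glues two of them, which closes a curve if they are the two ends of one arc. The
number of curves that a set of further joins closes depends only on the current pairing, so that
states with equal pairings can be merged. With a good order of the crossings few pairings arise even
for the 54 classical crossings of the 3-strand cable of `Km`. The weights are collected as digits of
a single number, from which the coefficients of the bracket polynomial are read off.

For the non-triviality, give the edges values in a commutative ring that change their sign with the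
direction of the edge, such that at a classical crossing the overstrand, entering with `x`, leaves
with `-x`, and the understrand, entering with `y`, leaves with `y + 2 * x`; virtual crossings have
no effect. These are the colourings by the Alexander biquandle with `s = -1` and `t = 1`, so that no
orientations of the strands are needed. Each move replaces a tangle by one with the same possible
boundary values, hence the module of colourings is an invariant. For the unknot it has rank one, but
`Km` is composed of two long virtual knots, and each of them has a colouring modulo 3 that vanishes
on the other one.
-/

/-! ### Gluing the arcs of a pairing -/

section Classes

variable {α β : Type}

/-- The elements that occur in a list of pairs. -/
def support (l : List (α × α)) : Set α := {x | ∃ p ∈ l, x = p.1 ∨ x = p.2}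

/-- The class of an element for the equivalence relation generated by a list of pairs. -/
def classOf (l : List (α × α)) (x : α) : Quot (fun x y => (x, y) ∈ l) := Quot.mk _ x

theorem numClasses_eq_ncard_image (l : List (α × α)) :
    numClasses l = (classOf l '' support l).ncard := rfl

theorem classOf_eq {l : List (α × α)} {x y : α} (h : (x, y) ∈ l) : classOf l x = classOf l y :=
  Quot.sound h

theorem support_cons (p : α × α) (l : List (α × α)) :
    support (p :: l) = insert p.1 (insert p.2 (support l)) := by
  ext x
  simp only [support, List.exists_mem_cons_iff, Set.mem_ofPred_eq, Set.mem_insert_iff, or_assoc]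

theorem fst_mem_support {l : List (α × α)} {x y : α} (h : (x, y) ∈ l) : x ∈ support l :=
  ⟨_, h, Or.inl rfl⟩

theorem snd_mem_support {l : List (α × α)} {x y : α} (h : (x, y) ∈ l) : y ∈ support l :=
  ⟨_, h, Or.inr rfl⟩

theorem finite_support (l : List (α × α)) : (support l).Finite := by
  induction l with
  | nil => simp [support]
  | cons p l ih => rw [support_cons]; exact (ih.insert _).insert _

theorem numClasses_congr {l : List (α × α)} {l' : List (β × β)} (f : α → β) (g : β → α)
    (hf : ∀ x y, (x, y) ∈ l → classOf l' (f x) = classOf l' (f y))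
    (hg : ∀ x y, (x, y) ∈ l' → classOf l (g x) = classOf l (g y))
    (hfs : Set.MapsTo f (support l) (support l')) (hgs : Set.MapsTo g (support l') (support l))
    (hgf : ∀ x ∈ support l, classOf l (g (f x)) = classOf l x)
    (hfg : ∀ x ∈ support l', classOf l' (f (g x)) = classOf l' x) :
    numClasses l = numClasses l' := by
  let F : Quot (fun x y => (x, y) ∈ l) → Quot (fun x y => (x, y) ∈ l') :=
    Quot.lift (fun x => classOf l' (f x)) hf
  let G : Quot (fun x y => (x, y) ∈ l') → Quot (fun x y => (x, y) ∈ l) :=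
    Quot.lift (fun x => classOf l (g x)) hg
  have hF : Set.InjOn F (classOf l '' support l) := by
    refine Set.LeftInvOn.injOn (f₁' := G) ?_
    rintro _ ⟨x, hx, rfl⟩
    exact hgf x hx
  have himage : F '' (classOf l '' support l) = classOf l' '' support l' := by
    ext z
    constructor
    · rintro ⟨_, ⟨x, hx, rfl⟩, rfl⟩
      exact ⟨f x, hfs hx, rfl⟩
    · rintro ⟨y, hy, rfl⟩
      exact ⟨_, ⟨g y, hgs hy, rfl⟩, hfg y hy⟩
  rw [numClasses_eq_ncard_image, numClasses_eq_ncard_image, ← himage, hF.ncard_image]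

theorem numClasses_congr_swap {l l' : List (α × α)}
    (h : ∀ x y, (x, y) ∈ l → (x, y) ∈ l' ∨ (y, x) ∈ l')
    (h' : ∀ x y, (x, y) ∈ l' → (x, y) ∈ l ∨ (y, x) ∈ l) : numClasses l = numClasses l' := by
  have support_le : ∀ {l l' : List (α × α)}, (∀ x y, (x, y) ∈ l → (x, y) ∈ l' ∨ (y, x) ∈ l') →
      Set.MapsTo id (support l) (support l') := by
    rintro l l' h x ⟨⟨a, b⟩, hp, rfl | rfl⟩
    · exact (h _ _ hp).elim fst_mem_support snd_mem_support
    · exact (h _ _ hp).elim snd_mem_support fst_mem_support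
  exact numClasses_congr id id
    (fun x y hp => (h x y hp).elim classOf_eq fun h => (classOf_eq h).symm)
    (fun x y hp => (h' x y hp).elim classOf_eq fun h => (classOf_eq h).symm)
    (support_le h) (support_le h') (fun _ _ => rfl) fun _ _ => rfl

theorem numClasses_congr_perm {l l' : List (α × α)} (h : l.Perm l') :
    numClasses l = numClasses l' :=
  numClasses_congr_swap (fun _ _ hp => Or.inl (h.mem_iff.1 hp)) fun _ _ hp =>
    Or.inl (h.mem_iff.2 hp)

theorem numClasses_cons_cons_of_notMem_support {l : List (α × α)} {a b p : α}
    (hl : a ∉ support l) (hp : p ≠ a) (hb : b ≠ a) :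
    numClasses ((a, p) :: (a, b) :: l) = numClasses ((p, b) :: l) := by
  classical
  have hap : classOf ((a, p) :: (a, b) :: l) a = classOf ((a, p) :: (a, b) :: l) p :=
    classOf_eq (by simp)
  have hab : classOf ((a, p) :: (a, b) :: l) a = classOf ((a, p) :: (a, b) :: l) b :=
    classOf_eq (by simp)
  have hl₁ : ∀ {x y}, (x, y) ∈ l → x ≠ a := fun h hx => hl (hx ▸ fst_mem_support h)
  have hl₂ : ∀ {x y}, (x, y) ∈ l → y ≠ a := fun h hy => hl (hy ▸ snd_mem_support h)
  refine numClasses_congr (fun x => if x = a then p else x) id ?_ ?_ ?_ ?_ ?_ ?_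
  · intro x y h
    simp only [List.mem_cons, Prod.mk.injEq] at h
    rcases h with ⟨rfl, rfl⟩ | ⟨rfl, rfl⟩ | h
    · simp only [ite_true, if_neg hp]
    · simp only [ite_true, if_neg hb]
      exact classOf_eq List.mem_cons_self
    · rw [if_neg (hl₁ h), if_neg (hl₂ h)]
      exact classOf_eq (List.mem_cons_of_mem _ h)
  · intro x y h
    simp only [List.mem_cons, Prod.mk.injEq] at h
    rcases h with ⟨rfl, rfl⟩ | h
    · exact hap.symm.trans hab
    · exact classOf_eq (by simp [h])
  · intro x hx
    simp only [support_cons, Set.mem_insert_iff] at hx ⊢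
    grind
  · intro x hx
    simp only [support_cons, Set.mem_insert_iff, id] at hx ⊢
    grind
  · intro x _
    by_cases h : x = a
    · simp [h, hap]
    · simp [h]
  · intro x hx
    simp only [support_cons, Set.mem_insert_iff] at hx
    rw [id, if_neg]
    rintro rfl
    grind

theorem numClasses_cons_self {l : List (α × α)} {a : α} (hl : a ∉ support l) :
    numClasses ((a, a) :: l) = numClasses l + 1 := by
  let F : Quot (fun x y => (x, y) ∈ l) → Quot (fun x y => (x, y) ∈ (a, a) :: l) :=
    Quot.lift (classOf _) fun x y h => classOf_eq (List.mem_cons_of_mem _ h)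
  let G : Quot (fun x y => (x, y) ∈ (a, a) :: l) → Quot (fun x y => (x, y) ∈ l) :=
    Quot.lift (classOf _) fun x y h => by
      simp only [List.mem_cons, Prod.mk.injEq] at h
      rcases h with ⟨rfl, rfl⟩ | h
      · rfl
      · exact classOf_eq h
  have hGF : Function.LeftInverse G F := by rintro ⟨x⟩; rfl
  have himage : classOf ((a, a) :: l) '' support ((a, a) :: l) =
      insert (classOf ((a, a) :: l) a) (F '' (classOf l '' support l)) := by
    rw [support_cons, Set.insert_eq_of_mem (Set.mem_insert a _), Set.image_insert_eq,
      Set.image_image]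
    rfl
  have hnotMem : classOf ((a, a) :: l) a ∉ F '' (classOf l '' support l) := by
    rintro ⟨_, ⟨x, hx, rfl⟩, h⟩
    let isA : Quot (fun x y => (x, y) ∈ (a, a) :: l) → Prop := Quot.lift (fun x => x = a) (by
      intro x y h
      simp only [List.mem_cons, Prod.mk.injEq] at h
      rcases h with ⟨rfl, rfl⟩ | h
      · rfl
      · refine propext ⟨fun h' => absurd (fst_mem_support h) ?_,
          fun h' => absurd (snd_mem_support h) ?_⟩ <;> rwa [h'])
    exact hl ((congrArg isA h).mpr rfl ▸ hx)
  rw [numClasses_eq_ncard_image, himage,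
    Set.ncard_insert_of_notMem hnotMem (((finite_support l).image _).image _),
    Set.ncard_image_of_injective _ hGF.injective, numClasses_eq_ncard_image]

theorem numClasses_cons_of_notMem_support {l : List (α × α)} {a b : α} (ha : a ∉ support l)
    (hb : b ∉ support l) : numClasses ((a, b) :: l) = numClasses l + 1 := by
  by_cases hab : a = b
  · rw [hab, numClasses_cons_self hb]
  · rw [← numClasses_cons_self hb,
      ← numClasses_cons_cons_of_notMem_support ha (Ne.symm hab) (Ne.symm hab)]
    refine numClasses_congr_swap (fun x y h => Or.inl ?_) fun x y h => Or.inl ?_ <;>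
      simpa only [List.mem_cons, or_self_left] using h

end Classes

section Joining

variable {α : Type}

/-- `g` restricts to an involution of the members of `s`. It records a system of arcs in the plane:
`g c` is the other end of the arc with end `c`, and `g c = c` if no arc ends at `c`. -/
def IsPairing (s : List α) (g : α → α) : Prop := ∀ c ∈ s, g c ∈ s ∧ g (g c) = c

/-- The ends that occur in a list of joins, with multiplicity. -/
def joinedEnds (js : List (α × α)) : List α := js.flatMap fun p => [p.1, p.2]

theorem mem_support_iff_mem_joinedEnds {js : List (α × α)} {c : α} :
    c ∈ support js ↔ c ∈ joinedEnds js := by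
  simp [support, joinedEnds]

variable [DecidableEq α]

/-- The arcs of a pairing, each listed from both of its ends. -/
def arcs (s : List α) (g : α → α) : List (α × α) :=
  (s.filter fun c => g c ≠ c).map fun c => (c, g c)

/-- The pairing that arises when the arcs that end at `p` and at `q` are glued there. -/
def join (g : α → α) (p q : α) : α → α :=
  Function.update (Function.update (Function.update (Function.update g (g p) (g q)) (g q) (g p))
    p p) q q

/-- The number of closed curves that arise when the arcs of a pairing are glued successively at the
listed pairs of ends. -/
def numLoops : (α → α) → List (α × α) → ℕ
  | _, [] => 0
  | g, (p, q) :: js => (if g p = q then 1 else 0) + numLoops (join g p q) js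

theorem mem_arcs {s : List α} {g : α → α} {x y : α} :
    (x, y) ∈ arcs s g ↔ x ∈ s ∧ g x = y ∧ x ≠ y := by
  simp only [arcs, List.mem_map, List.mem_filter, decide_eq_true_eq, Prod.mk.injEq]
  grind

theorem IsPairing.join {s : List α} {g : α → α} (hg : IsPairing s g) {p q : α} (hp : p ∈ s)
    (hq : q ∈ s) (hgp : g p ≠ p) (hgq : g q ≠ q) : IsPairing s (join g p q) := by
  intro c hc
  have hinv := fun c hc => (hg c hc).2
  have hmem := fun c hc => (hg c hc).1
  simp only [VirtualKnotTheory.join, Function.update_apply]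
  grind

theorem join_ne_self_iff {s : List α} {g : α → α} (hg : IsPairing s g) {p q : α} (hp : p ∈ s)
    (hq : q ∈ s) (hpq : p ≠ q) {c : α} (hc : c ∈ s) :
    join g p q c ≠ c ↔ g c ≠ c ∧ c ≠ p ∧ c ≠ q := by
  have hinv := fun c hc => (hg c hc).2
  simp only [join, Function.update_apply]
  grind

theorem numClasses_cons_append_arcs {s : List α} {g : α → α} (hg : IsPairing s g) {p q : α}
    (hp : p ∈ s) (hq : q ∈ s) (hpq : p ≠ q) (hgp : g p ≠ p) (hgq : g q ≠ q) {R : List (α × α)}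
    (hpR : p ∉ support R) (hqR : q ∉ support R) :
    numClasses ((p, q) :: (R ++ arcs s g)) =
      (if g p = q then 1 else 0) + numClasses (R ++ arcs s (join g p q)) := by
  have hinv := fun c hc => (hg c hc).2
  have hmem := fun c hc => (hg c hc).1
  have hR₁ : ∀ {x y}, (x, y) ∈ R → x ≠ p ∧ x ≠ q := fun h =>
    ⟨fun hx => hpR (hx ▸ fst_mem_support h), fun hx => hqR (hx ▸ fst_mem_support h)⟩
  have hR₂ : ∀ {x y}, (x, y) ∈ R → y ≠ p ∧ y ≠ q := fun h =>
    ⟨fun hy => hpR (hy ▸ snd_mem_support h), fun hy => hqR (hy ▸ snd_mem_support h)⟩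
  let others := R ++ arcs (s.filter fun c => c ≠ p ∧ c ≠ q ∧ c ≠ g p ∧ c ≠ g q) g
  have hmem_others : ∀ x y, (x, y) ∈ others ↔
      (x, y) ∈ R ∨ (x ∈ s ∧ x ≠ p ∧ x ≠ q ∧ x ≠ g p ∧ x ≠ g q) ∧ g x = y ∧ x ≠ y := by
    simp [others, mem_arcs]
  have hp_others : p ∉ support others := by
    rintro ⟨⟨x, y⟩, h, h' | h'⟩ <;> rw [hmem_others] at h <;> grind
  have hq_others : q ∉ support others := by
    rintro ⟨⟨x, y⟩, h, h' | h'⟩ <;> rw [hmem_others] at h <;> grind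
  by_cases hloop : g p = q
  · rw [if_pos hloop, add_comm]
    have hjoin : numClasses (R ++ arcs s (join g p q)) = numClasses others := by
      refine numClasses_congr_swap (fun x y h => ?_) fun x y h => ?_ <;>
        simp only [hmem_others, List.mem_append, mem_arcs, join, Function.update_apply] at h ⊢ <;>
        grind
    rw [hjoin, ← numClasses_cons_of_notMem_support hp_others hq_others]
    have hgq' : g q = p := hloop ▸ hinv p hp
    refine numClasses_congr_swap (fun x y h => ?_) fun x y h => ?_ <;>
      simp only [hmem_others, hloop, hgq', List.mem_cons, List.mem_append, mem_arcs, Prod.mk.injEq]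
        at h ⊢ <;>
      rcases h with h | h | h <;> grind
  · rw [if_neg hloop, zero_add]
    calc numClasses ((p, q) :: (R ++ arcs s g))
      _ = numClasses ((p, q) :: (p, g p) :: (q, g q) :: others) := by
        refine numClasses_congr_swap (fun x y h => ?_) fun x y h => ?_ <;>
          simp only [hmem_others, List.mem_cons, List.mem_append, mem_arcs, Prod.mk.injEq]
            at h ⊢ <;>
          rcases h with h | h | h <;> grind
      _ = numClasses ((q, g p) :: (q, g q) :: others) := by
        refine numClasses_cons_cons_of_notMem_support ?_ (Ne.symm hpq) hgp
        rw [support_cons, Set.mem_insert_iff, Set.mem_insert_iff]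
        grind
      _ = numClasses ((g p, g q) :: others) :=
        numClasses_cons_cons_of_notMem_support hq_others hloop hgq
      _ = numClasses (R ++ arcs s (join g p q)) := by
        refine numClasses_congr_swap (fun x y h => ?_) fun x y h => ?_ <;>
          simp only [hmem_others, List.mem_cons, List.mem_append, mem_arcs, Prod.mk.injEq, join,
            Function.update_apply] at h ⊢ <;>
          grind

theorem numClasses_append_arcs {s : List α} {g : α → α} (hg : IsPairing s g)
    {js : List (α × α)} (hjs : (joinedEnds js).Nodup)
    (hmoved : ∀ c, c ∈ joinedEnds js ↔ c ∈ s ∧ g c ≠ c) :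
    numClasses (js ++ arcs s g) = numLoops g js := by
  induction js generalizing g with
  | nil =>
    have harcs : arcs s g = [] := by
      simp only [arcs, List.map_eq_nil_iff, List.filter_eq_nil_iff]
      simpa [joinedEnds] using hmoved
    simp [harcs, numClasses, numLoops]
  | cons pq js ih =>
    obtain ⟨p, q⟩ := pq
    have hends : joinedEnds ((p, q) :: js) = p :: q :: joinedEnds js := rfl
    simp only [hends, List.nodup_cons, List.mem_cons, not_or] at hjs hmoved
    obtain ⟨⟨hpq, hpjs⟩, hqjs, hjs⟩ := hjs
    obtain ⟨hp, hgp⟩ := (hmoved p).1 (by simp)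
    obtain ⟨hq, hgq⟩ := (hmoved q).1 (by simp)
    rw [List.cons_append, numClasses_cons_append_arcs hg hp hq hpq hgp hgq
      (mem_support_iff_mem_joinedEnds.not.2 hpjs) (mem_support_iff_mem_joinedEnds.not.2 hqjs),
      ih (hg.join hp hq hgp hgq) hjs, numLoops]
    intro c
    have hjoin := fun hc => join_ne_self_iff (c := c) hg hp hq hpq hc
    grind

theorem numLoops_append (g : α → α) (js js' : List (α × α)) :
    numLoops g (js ++ js') =
      numLoops g js + numLoops (js.foldl (fun g p => join g p.1 p.2) g) js' := by
  induction js generalizing g with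
  | nil => simp [numLoops]
  | cons p js ih => rw [List.cons_append, numLoops, numLoops, ih, List.foldl_cons, add_assoc]

variable {β : Type} [DecidableEq β] in
theorem numLoops_map {s : List α} {f : α → β} (hf : ∀ x ∈ s, ∀ y ∈ s, f x = f y → x = y)
    {g : α → α} {g' : β → β} (hg : ∀ c ∈ s, g c ∈ s) (hg' : ∀ c ∈ s, g' (f c) = f (g c))
    {js : List (α × α)} (hjs : ∀ c ∈ joinedEnds js, c ∈ s) :
    numLoops g' (js.map (Prod.map f f)) = numLoops g js := by
  induction js generalizing g g' with
  | nil => rfl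
  | cons pq js ih =>
    obtain ⟨p, q⟩ := pq
    obtain ⟨hp, hq, hjs⟩ : p ∈ s ∧ q ∈ s ∧ ∀ c ∈ joinedEnds js, c ∈ s := by
      simpa [joinedEnds] using hjs
    have hloop : f (g p) = f q ↔ g p = q := ⟨hf _ (hg p hp) q hq, congrArg f⟩
    have hjoin : ∀ c ∈ s, join g p q c ∈ s := by
      intro c hc
      simp only [join, Function.update_apply]
      grind
    have hjoin' : ∀ c ∈ s, join g' (f p) (f q) (f c) = f (join g p q c) := by
      intro c hc
      simp only [join, Function.update_apply, hg' p hp, hg' q hq]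
      grind
    simp only [List.map_cons, Prod.map_apply, numLoops, hg' p hp, hloop, ih hjoin hjoin' hjs]

end Joining

/-! ### State sums -/

section States

variable {L α β : Type}

theorem HalfEdge.flip_flip (h : HalfEdge L) : h.flip.flip = h := by simp [flip]

theorem HalfEdge.flip_ne (h : HalfEdge L) : h.flip ≠ h := by
  simp [flip, Prod.ext_iff]

theorem numCurves_eq_numClasses_append_arcs [DecidableEq L] {js : List (HalfEdge L × HalfEdge L)}
    (hflip : ∀ h ∈ joinedEnds js, h.flip ∈ joinedEnds js) :
    numCurves js = numClasses (js ++ arcs (joinedEnds js) HalfEdge.flip) := by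
  set l := js ++ arcs (joinedEnds js) HalfEdge.flip
  have hends : ∀ p ∈ js, p.1 ∈ joinedEnds js ∧ p.2 ∈ joinedEnds js := fun p hp =>
    ⟨mem_support_iff_mem_joinedEnds.1 (fst_mem_support hp),
      mem_support_iff_mem_joinedEnds.1 (snd_mem_support hp)⟩
  have hsupport : ∀ h, h ∈ support l ↔ h ∈ joinedEnds js := by
    refine fun h => ⟨?_, fun hh => ?_⟩
    · rintro ⟨⟨x, y⟩, hp, hh⟩
      rcases List.mem_append.1 hp with hp | hp
      · exact mem_support_iff_mem_joinedEnds.1 ⟨_, hp, hh⟩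
      · obtain ⟨hx, rfl, -⟩ := mem_arcs.1 hp
        rcases hh with rfl | rfl
        exacts [hx, hflip _ hx]
    · obtain ⟨p, hp, hh⟩ := mem_support_iff_mem_joinedEnds.2 hh
      exact ⟨p, List.mem_append_left _ hp, hh⟩
  have htrue : ∀ h ∈ joinedEnds js, (h.1, true) ∈ joinedEnds js ∧
      classOf l (h.1, true) = classOf l h := by
    rintro ⟨e, _ | _⟩ hh
    · exact ⟨hflip _ hh, (classOf_eq (List.mem_append_right _
        (mem_arcs.2 ⟨hh, rfl, (HalfEdge.flip_ne _).symm⟩))).symm⟩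
    · exact ⟨hh, rfl⟩
  refine numClasses_congr (fun e => (e, true)) Prod.fst ?_ ?_ ?_ ?_ (fun _ _ => rfl)
    fun h hh => (htrue h ((hsupport h).1 hh)).2
  · intro x y hxy
    obtain ⟨p, hp, hxy⟩ := List.mem_map.1 hxy
    obtain ⟨rfl, rfl⟩ := Prod.mk.inj hxy
    rw [(htrue _ (hends p hp).1).2, (htrue _ (hends p hp).2).2]
    exact classOf_eq (List.mem_append_left _ hp)
  · intro x y hxy
    rcases List.mem_append.1 hxy with hxy | hxy
    · exact classOf_eq (List.mem_map_of_mem hxy)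
    · obtain ⟨-, rfl, -⟩ := mem_arcs.1 hxy
      rfl
  · rintro e ⟨_, he, heq⟩
    obtain ⟨p, hp, rfl⟩ := List.mem_map.1 he
    rcases heq with rfl | rfl
    exacts [(hsupport _).2 (htrue _ (hends p hp).1).1, (hsupport _).2 (htrue _ (hends p hp).2).1]
  · intro h hh
    obtain ⟨p, hp, heq⟩ := mem_support_iff_mem_joinedEnds.2 ((hsupport h).1 hh)
    exact ⟨_, List.mem_map_of_mem hp, heq.imp (congrArg Prod.fst) (congrArg Prod.fst)⟩

theorem numCurves_eq_numLoops [DecidableEq L] {js : List (HalfEdge L × HalfEdge L)}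
    (hjs : (joinedEnds js).Nodup) (hflip : ∀ h ∈ joinedEnds js, h.flip ∈ joinedEnds js) :
    numCurves js = numLoops HalfEdge.flip js := by
  rw [numCurves_eq_numClasses_append_arcs hflip]
  exact numClasses_append_arcs (fun h hh => ⟨hflip h hh, h.flip_flip⟩) hjs fun h =>
    (and_iff_left h.flip_ne).symm

/-- Whether a vertex is a classical crossing. -/
def Vertex.isClassical : Vertex L → Bool
  | .classical _ _ _ _ => true
  | _ => false

/-- The ways to smooth a vertex: for each of them the number of `α`-smoothings it contributes (0 or
1) and the joins, with the half-edges renamed by `f`. -/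
def Vertex.smoothings (f : HalfEdge L → α) : Vertex L → List (ℕ × List (α × α))
  | .classical a b c e => [(1, [(f a, f b), (f c, f e)]), (0, [(f a, f e), (f b, f c)])]
  | .virtual a b c e => [(0, [(f a, f c), (f b, f e)])]
  | .point a b => [(0, [(f a, f b)])]

/-- The combined smoothings of a list of vertices, given by the smoothings of each of them. -/
def choices : List (List (ℕ × List (α × α))) → List (ℕ × List (α × α))
  | [] => [(0, [])]
  | σ :: V => σ.flatMap fun s => (choices V).map fun t => (s.1 + t.1, s.2 ++ t.2)

theorem sum_map_flatMap {M ι κ : Type*} [AddMonoid M] (l : List ι) (g : ι → List κ) (F : κ → M) :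
    ((l.flatMap g).map F).sum = (l.map fun i => ((g i).map F).sum).sum := by
  rw [List.map_flatMap, List.flatMap, List.sum_flatten, List.map_map]
  rfl

theorem sum_map_choices_cons {M : Type*} [AddMonoid M] (σ : List (ℕ × List (α × α)))
    (V : List (List (ℕ × List (α × α)))) (F : ℕ × List (α × α) → M) :
    ((choices (σ :: V)).map F).sum =
      (σ.map fun s => ((choices V).map fun t => F (s.1 + t.1, s.2 ++ t.2)).sum).sum := by
  rw [choices, sum_map_flatMap]
  simp only [List.map_map, Function.comp_def]

theorem choices_map (f : α → β) (V : List (List (ℕ × List (α × α)))) :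
    choices (V.map fun σ => σ.map fun s => (s.1, s.2.map (Prod.map f f))) =
      (choices V).map fun t => (t.1, t.2.map (Prod.map f f)) := by
  induction V with
  | nil => rfl
  | cons σ V ih =>
    simp only [List.map_cons, choices, ih, List.flatMap_map, List.map_flatMap, List.map_map,
      Function.comp_def, List.map_append]

theorem sum_map_choices_perm {M : Type*} [AddCommMonoid M] {V V' : List (List (ℕ × List (α × α)))}
    (hV : V.Perm V') {F : ℕ × List (α × α) → M}
    (hF : ∀ k js js', js.Perm js' → F (k, js) = F (k, js')) :
    ((choices V).map F).sum = ((choices V').map F).sum := by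
  induction hV generalizing F with
  | nil => rfl
  | cons σ _ ih =>
    rw [sum_map_choices_cons, sum_map_choices_cons]
    congr 2
    funext s
    exact ih fun k js js' h => hF _ _ _ (h.append_left _)
  | swap σ τ V =>
    simp only [sum_map_choices_cons]
    have hcomm := Multiset.sum_map_sum_map (σ : Multiset (ℕ × List (α × α)))
      (τ : Multiset (ℕ × List (α × α)))
      (f := fun s t : ℕ × List (α × α) => ((choices V).map fun u =>
        F (t.1 + (s.1 + u.1), t.2 ++ (s.2 ++ u.2))).sum)
    simp only [Multiset.map_coe, Multiset.sum_coe] at hcomm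
    rw [← hcomm]
    refine congrArg List.sum (List.map_congr_left fun s _ => congrArg List.sum
      (List.map_congr_left fun t _ => congrArg List.sum (List.map_congr_left fun u _ => ?_)))
    rw [add_left_comm]
    refine hF _ _ _ ?_
    rw [← List.append_assoc, ← List.append_assoc]
    exact List.perm_append_comm.append_right _
  | trans _ _ ih₁ ih₂ => exact (ih₁ hF).trans (ih₂ hF)

theorem sum_map_states {M : Type*} [AddCommMonoid M] (D : Diagram L) (F : ℤ → _ → M) :
    ((states D).map fun s => F s.c s.joins).sum = ((choices (D.map (Vertex.smoothings id))).map
      fun t => F (2 * t.1 - D.countP Vertex.isClassical) t.2).sum := by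
  induction D generalizing F with
  | nil => simp [states, choices]
  | cons v D ih =>
    rw [List.map_cons, sum_map_choices_cons]
    cases v with
    | classical a b c e =>
      have hα : ∀ k n : ℕ, 2 * ((1 + k : ℕ) : ℤ) - (n + 1 : ℕ) = 2 * k - n + 1 := by grind
      have hβ : ∀ k n : ℕ, 2 * ((0 + k : ℕ) : ℤ) - (n + 1 : ℕ) = 2 * k - n - 1 := by grind
      have h₁ := ih fun k js => F (k + 1) ((a, b) :: (c, e) :: js)
      have h₂ := ih fun k js => F (k - 1) ((a, e) :: (b, c) :: js)
      simp only [states, sum_map_flatMap, List.map_cons, List.map_nil, List.sum_cons,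
        List.sum_nil, add_zero, List.sum_map_add, h₁, h₂, Vertex.smoothings, id,
        List.countP_cons, Vertex.isClassical, if_true, List.cons_append, List.nil_append, hα, hβ]
    | virtual a b c e =>
      have h := ih fun k js => F k ((a, c) :: (b, e) :: js)
      simpa [states, Vertex.smoothings, Vertex.isClassical, Function.comp_def] using h
    | point a b =>
      have h := ih fun k js => F k ((a, b) :: js)
      simpa [states, Vertex.smoothings, Vertex.isClassical, Function.comp_def] using h

open LaurentPolynomial in
theorem bracket_eq_sum_choices (D : Diagram L) :
    bracket D = ((choices (D.map (Vertex.smoothings id))).map fun t =>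
      T (2 * t.1 - D.countP Vertex.isClassical : ℤ) * d ^ (numCurves t.2 - 1)).sum :=
  sum_map_states D fun k js => T k * d ^ (numCurves js - 1)

theorem bracket_perm {D D' : Diagram L} (h : D.Perm D') : bracket D = bracket D' := by
  rw [bracket_eq_sum_choices, bracket_eq_sum_choices, h.countP_eq]
  refine sum_map_choices_perm (h.map _) fun k js js' hjs => ?_
  rw [numCurves, numCurves, numClasses_congr_perm (hjs.map _)]

theorem joinedEnds_perm_ends {D : Diagram L} {t : ℕ × List (HalfEdge L × HalfEdge L)}
    (ht : t ∈ choices (D.map (Vertex.smoothings id))) : (joinedEnds t.2).Perm (ends D) := by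
  induction D generalizing t with
  | nil =>
    obtain rfl : t = (0, []) := by simpa [choices] using ht
    rfl
  | cons v D ih =>
    simp only [List.map_cons, choices, List.mem_flatMap, List.mem_map] at ht
    obtain ⟨s, hs, u, hu, rfl⟩ := ht
    have hv : (joinedEnds s.2).Perm v.ends := by
      cases v <;> simp only [Vertex.smoothings, List.mem_cons, List.not_mem_nil, or_false] at hs
      case classical a b c e =>
        rcases hs with rfl | rfl
        · rfl
        · exact (List.perm_append_comm (l₁ := [e]) (l₂ := [b, c])).cons a
      case virtual a b c e =>
        subst hs
        exact (List.Perm.swap b c [e]).cons a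
      case point => subst hs; rfl
    simpa only [joinedEnds, List.flatMap_append, ends, List.flatMap_cons] using hv.append (ih hu)

theorem fst_le_countP_of_mem_choices {D : Diagram L} {t : ℕ × List (HalfEdge L × HalfEdge L)}
    (ht : t ∈ choices (D.map (Vertex.smoothings id))) : t.1 ≤ D.countP Vertex.isClassical := by
  induction D generalizing t with
  | nil =>
    obtain rfl : t = (0, []) := by simpa [choices] using ht
    rfl
  | cons v D ih =>
    simp only [List.map_cons, choices, List.mem_flatMap, List.mem_map] at ht
    obtain ⟨s, hs, u, hu, rfl⟩ := ht
    have hu := ih hu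
    cases v <;> simp only [Vertex.smoothings, List.mem_cons, List.not_mem_nil, or_false] at hs
    case classical =>
      rw [List.countP_cons_of_pos rfl]
      rcases hs with rfl | rfl <;> lia
    all_goals subst hs; simpa [Vertex.isClassical] using hu

theorem length_choices (D : Diagram L) :
    (choices (D.map (Vertex.smoothings id))).length = 2 ^ D.countP Vertex.isClassical := by
  induction D with
  | nil => rfl
  | cons v D ih =>
    cases v <;>
      simp [choices, Vertex.smoothings, Vertex.isClassical, ih, List.countP_cons, pow_succ']
    lia

end States

section Transfer

-- The kernel evaluates the functions below. Their inner loops are written with `Nat.add`, `Nat.mul`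
-- and so on instead of `+` and `*`, and with recursors instead of pattern matching, because the
-- kernel would spend most of its time on unfolding these.

/-- `k n`. In contrast to the plain application, the kernel evaluates `n` to a literal before it
substitutes it in `k`, so that the computation of `n` is not repeated. -/
def force {R : Type*} (n : ℕ) (k : ℕ → R) : R :=
  Nat.rec (motive := fun _ => R) (k 0) (fun m _ => k (Nat.succ m)) n

theorem force_eq {R : Type*} (n : ℕ) (k : ℕ → R) : force n k = k n := by cases n <;> rfl

/-- The digit at position `a` of `m` in base `B`. The function `digit B m` is the function `ℕ → ℕ`
that the number `m` encodes. -/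
def digit (B m a : ℕ) : ℕ := Nat.mod (Nat.div m (Nat.pow B a)) B

/-- Replace the digit at position `a` by `v`. -/
def putDigit (B a v m : ℕ) : ℕ :=
  Nat.sub (Nat.add m (Nat.mul v (Nat.pow B a))) (Nat.mul (digit B m a) (Nat.pow B a))

theorem digit_eq (B m a : ℕ) : digit B m a = m / B ^ a % B := rfl

theorem putDigit_eq (B a v m : ℕ) : putDigit B a v m = m + v * B ^ a - digit B m a * B ^ a := rfl

theorem digit_add_mul_pow {B : ℕ} (hB : 0 < B) (m v a b : ℕ) :
    digit B (m + v * B ^ a) b = if b < a then digit B m b else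
      (m / B ^ a + v) / B ^ (b - a) % B := by
  simp only [digit_eq]
  split_ifs with h
  · obtain ⟨c, rfl⟩ := Nat.exists_eq_add_of_lt h
    rw [show v * B ^ (b + c + 1) = B ^ b * (B * (v * B ^ c)) by ring,
      Nat.add_mul_div_left _ _ (Nat.pow_pos hB), Nat.add_mul_mod_self_left]
  · obtain ⟨c, rfl⟩ := Nat.exists_eq_add_of_le (not_lt.1 h)
    rw [pow_add, ← Nat.div_div_eq_div_mul, Nat.add_mul_div_right _ _ (Nat.pow_pos hB),
      Nat.add_sub_cancel_left]

theorem digit_putDigit {B v : ℕ} (hv : v < B) (a m : ℕ) :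
    digit B (putDigit B a v m) = Function.update (digit B m) a v := by
  have hB : 0 < B := by lia
  have hle : digit B m a * B ^ a ≤ m :=
    (Nat.mul_le_mul_right _ (Nat.mod_le _ _)).trans (Nat.div_mul_le_self _ _)
  -- Below, `r` is `m` with the digit at `a` erased.
  obtain ⟨r, hr⟩ := Nat.exists_eq_add_of_le' hle
  have hput : putDigit B a v m = r + v * B ^ a := by rw [putDigit_eq]; lia
  have hdiv : m / B ^ a = r / B ^ a + digit B m a := by
    conv_lhs => rw [hr, Nat.add_mul_div_right _ _ (Nat.pow_pos hB)]
  have hdvd : r / B ^ a = B * (m / B ^ a / B) := by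
    have := Nat.div_add_mod (m / B ^ a) B
    rw [digit_eq] at hdiv
    lia
  funext b
  rw [hput, Function.update_apply]
  have hm := digit_add_mul_pow hB r (digit B m a) a b
  rw [← hr] at hm
  rw [hm, digit_add_mul_pow hB, hdvd]
  split_ifs with hba hab hab
  · lia
  · rfl
  · simp [hab, Nat.mod_eq_of_lt hv]
  · obtain ⟨c, hc⟩ := Nat.exists_eq_add_of_lt (lt_of_le_of_ne (not_lt.1 hba) (Ne.symm hab))
    have hdigit : digit B m a < B := Nat.mod_lt _ hB
    rw [show b - a = c + 1 by lia, pow_succ', ← Nat.div_div_eq_div_mul,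
      ← Nat.div_div_eq_div_mul, Nat.mul_add_div hB, Nat.mul_add_div hB, Nat.div_eq_of_lt hv,
      Nat.div_eq_of_lt hdigit]

/-- The number that encodes `join (digit B m) p q`. -/
def joinKey (B m p q : ℕ) : ℕ :=
  force (digit B m p) fun p' => force (digit B m q) fun q' =>
  putDigit B q q (putDigit B p p (putDigit B q' p' (putDigit B p' q' m)))

theorem digit_joinKey {B p q : ℕ} (hp : p < B) (hq : q < B) (m : ℕ) :
    digit B (joinKey B m p q) = join (digit B m) p q := by
  have hdigit : ∀ a, digit B m a < B := fun a => Nat.mod_lt _ (by lia)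
  simp only [joinKey, force_eq, join, digit_putDigit, hp, hq, hdigit]

/-- Finite sets of keys `m` with values `v`, as binary search trees. -/
inductive Table : Type
  | leaf
  | node (m v : ℕ) (l r : Table)

namespace Table

/-- `k t`, where the kernel evaluates `t` to a constructor before it substitutes it in `k`. -/
noncomputable def seq {R : Type*} (t : Table) (k : Table → R) : R :=
  Table.rec (motive := fun _ => R) (k leaf) (fun m v l r _ _ => k (node m v l r)) t

/-- Add `v` to the value at the key `m`. -/
noncomputable def add (m v : ℕ) (t : Table) : Table :=
  Table.rec (motive := fun _ => Table) (force v fun v => node m v leaf leaf)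
    (fun m' v' l r addl addr =>
      bif Nat.blt m m' then addl.seq fun l' => node m' v' l' r
      else bif Nat.beq m m' then force (v' + v) fun v'' => node m' v'' l r
      else addr.seq fun r' => node m' v' l r') t

/-- Apply the operations `f m v` for all keys `m` and their values `v` to a table. -/
noncomputable def fold (f : ℕ → ℕ → Table → Table) : Table → Table → Table
  | leaf, s => s
  | node m v l r, s => (f m v s).seq fun s => (l.fold f s).seq fun s => r.fold f s

/-- The sum of `v * G m` over all keys `m` and their values `v`. -/
def eval (G : ℕ → ℕ) : Table → ℕ
  | leaf => 0
  | node m v l r => v * G m + (l.eval G + r.eval G)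

theorem seq_eq {R : Type*} (t : Table) (k : Table → R) : t.seq k = k t := by cases t <;> rfl

theorem eval_add (G : ℕ → ℕ) (m v : ℕ) (t : Table) :
    (t.add m v).eval G = v * G m + t.eval G := by
  induction t with
  | leaf => simp only [add, force_eq, eval]
  | node m' v' l r ihl ihr =>
    have hadd : (node m' v' l r).add m v = bif Nat.blt m m' then node m' v' (l.add m v) r
        else bif Nat.beq m m' then node m' (v' + v) l r else node m' v' l (r.add m v) := by
      simp only [add, seq_eq, force_eq]
    rw [hadd]
    cases Nat.blt m m'
    · cases h : Nat.beq m m'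
      · simp only [cond_false, eval, ihr]; ring
      · simp only [cond_false, cond_true, eval, Nat.eq_of_beq_eq_true h]; ring
    · simp only [cond_true, eval, ihl]; ring

theorem eval_fold {f : ℕ → ℕ → Table → Table} {G H : ℕ → ℕ}
    (hf : ∀ m v s, (f m v s).eval G = v * H m + s.eval G) (t s : Table) :
    (t.fold f s).eval G = t.eval H + s.eval G := by
  induction t generalizing s with
  | leaf => simp [fold, eval]
  | node m v l r ihl ihr =>
    rw [fold, seq_eq, seq_eq, ihr, ihl, hf, eval]
    ring

end Table

/-- The sum of `X ^ (k + K * n)` over all choices of smoothings, where `k` is the number of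
`α`-smoothings and `n` the number of closed curves when the joins are applied to the pairing `g`. -/
def stateSum (X K : ℕ) (V : List (List (ℕ × List (ℕ × ℕ)))) (g : ℕ → ℕ) : ℕ :=
  ((choices V).map fun t => X ^ (t.1 + K * numLoops g t.2)).sum

/-- Join the listed ends in the pairing with key `m`, add `K` to `e` for each closed curve, and pass
the new key and the new value of `e` on to `k`. -/
noncomputable def joinAll (B K : ℕ) (js : List (ℕ × ℕ)) :
    ℕ → ℕ → (ℕ → ℕ → Table) → Table :=
  List.rec (motive := fun _ => ℕ → ℕ → (ℕ → ℕ → Table) → Table) (fun m e k => k m e)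
    (fun j _ joinTail m e k =>
      force (bif Nat.beq (digit B m j.1) j.2 then e + K else e) fun e =>
      force (joinKey B m j.1 j.2) fun m => joinTail m e k) js

/-- Add to a table the results of all smoothings `σ` of a vertex, applied to the pairing with key
`m` and value `v`. -/
noncomputable def smoothInto (B X K : ℕ) : List (ℕ × List (ℕ × ℕ)) → ℕ → ℕ → Table → Table
  | [], _, _, t => t
  | (k, js) :: σ, m, v, t =>
    (joinAll B K js m k fun m e => t.add m (Nat.mul v (Nat.pow X e))).seq fun t =>
      smoothInto B X K σ m v t

/-- `k (v.smoothings f)`, where the kernel evaluates the values of `f` before it substitutes them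
in `k`. -/
def Vertex.forceSmoothings {L : Type} {R : Type*} (f : HalfEdge L → ℕ) (v : Vertex L)
    (k : List (ℕ × List (ℕ × ℕ)) → R) : R :=
  match v with
  | .classical a b c e => force (f a) fun a => force (f b) fun b => force (f c) fun c =>
    force (f e) fun e => k [(1, [(a, b), (c, e)]), (0, [(a, e), (b, c)])]
  | .virtual a b c e => force (f a) fun a => force (f b) fun b => force (f c) fun c =>
    force (f e) fun e => k [(0, [(a, c), (b, e)])]
  | .point a b => force (f a) fun a => force (f b) fun b => k [(0, [(a, b)])]

/-- Apply all smoothings of the vertices one after the other to all pairings in a table. The number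
of the half-edge `h` is `f h`. -/
noncomputable def smoothAll {L : Type} (B X K : ℕ) (f : HalfEdge L → ℕ) : Diagram L → Table → Table
  | [], t => t
  | v :: D, t => v.forceSmoothings f fun σ =>
    (t.fold (smoothInto B X K σ) .leaf).seq fun t => smoothAll B X K f D t

variable {B : ℕ}

theorem digit_foldl_joinKey {js : List (ℕ × ℕ)} (hjs : ∀ c ∈ joinedEnds js, c < B) (m : ℕ) :
    digit B (js.foldl (fun m p => joinKey B m p.1 p.2) m) =
      js.foldl (fun g p => join g p.1 p.2) (digit B m) := by
  induction js generalizing m with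
  | nil => rfl
  | cons p js ih =>
    obtain ⟨hp, hq, hjs⟩ : p.1 < B ∧ p.2 < B ∧ ∀ c ∈ joinedEnds js, c < B := by
      simpa [joinedEnds] using hjs
    rw [List.foldl_cons, List.foldl_cons, ih hjs, digit_joinKey hp hq]

theorem joinAll_eq {js : List (ℕ × ℕ)} (hjs : ∀ c ∈ joinedEnds js, c < B) (K m e : ℕ)
    (k : ℕ → ℕ → Table) :
    joinAll B K js m e k = k (js.foldl (fun m p => joinKey B m p.1 p.2) m)
      (e + K * numLoops (digit B m) js) := by
  induction js generalizing m e with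
  | nil => simp [joinAll, numLoops]
  | cons p js ih =>
    obtain ⟨hp, hq, hjs⟩ : p.1 < B ∧ p.2 < B ∧ ∀ c ∈ joinedEnds js, c < B := by
      simpa [joinedEnds] using hjs
    have hcons : joinAll B K (p :: js) m e k = joinAll B K js (joinKey B m p.1 p.2)
        (bif Nat.beq (digit B m p.1) p.2 then e + K else e) k := by
      simp only [joinAll, force_eq]
    rw [hcons, ih hjs, digit_joinKey hp hq, List.foldl_cons, numLoops]
    congr 1
    cases h : Nat.beq (digit B m p.1) p.2
    · rw [if_neg (Nat.ne_of_beq_eq_false h), cond_false, zero_add]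
    · rw [if_pos (Nat.eq_of_beq_eq_true h), cond_true, mul_add, mul_one, add_assoc]

theorem stateSum_cons (X K : ℕ) (σ : List (ℕ × List (ℕ × ℕ)))
    (V : List (List (ℕ × List (ℕ × ℕ)))) (g : ℕ → ℕ) :
    stateSum X K (σ :: V) g = (σ.map fun s => X ^ (s.1 + K * numLoops g s.2) *
      stateSum X K V (s.2.foldl (fun g p => join g p.1 p.2) g)).sum := by
  simp only [stateSum, sum_map_choices_cons, ← List.sum_map_mul_left, numLoops_append, ← pow_add,
    mul_add, add_add_add_comm]

theorem eval_smoothInto {σ : List (ℕ × List (ℕ × ℕ))}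
    (hσ : ∀ s ∈ σ, ∀ c ∈ joinedEnds s.2, c < B) (X K : ℕ) (V : List (List (ℕ × List (ℕ × ℕ))))
    (m v : ℕ) (t : Table) :
    (smoothInto B X K σ m v t).eval (fun m => stateSum X K V (digit B m)) =
      v * stateSum X K (σ :: V) (digit B m) + t.eval fun m => stateSum X K V (digit B m) := by
  rw [stateSum_cons]
  induction σ generalizing t with
  | nil => simp [smoothInto]
  | cons s σ ih =>
    rw [List.forall_mem_cons] at hσ
    rw [smoothInto, Table.seq_eq, ih hσ.2, joinAll_eq hσ.1, Table.eval_add,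
      digit_foldl_joinKey hσ.1, List.map_cons, List.sum_cons, Nat.mul_eq, Nat.pow_eq]
    ring

theorem Vertex.forceSmoothings_eq {L : Type} {R : Type*} (f : HalfEdge L → ℕ) (v : Vertex L)
    (k : List (ℕ × List (ℕ × ℕ)) → R) : v.forceSmoothings f k = k (v.smoothings f) := by
  cases v <;> simp only [forceSmoothings, force_eq, smoothings]

theorem Vertex.lt_of_mem_smoothings {L : Type} {f : HalfEdge L → ℕ} {v : Vertex L}
    (hv : ∀ h ∈ v.ends, f h < B) {s : ℕ × List (ℕ × ℕ)} (hs : s ∈ v.smoothings f) {c : ℕ}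
    (hc : c ∈ joinedEnds s.2) : c < B := by
  cases v <;> simp only [smoothings, ends, List.mem_cons, List.not_mem_nil, or_false] at hs hv
  case classical => rcases hs with rfl | rfl <;> simp [joinedEnds] at hc <;> grind
  all_goals subst hs; simp [joinedEnds] at hc; grind

theorem eval_smoothAll {L : Type} {f : HalfEdge L → ℕ} {D : Diagram L}
    (hD : ∀ h ∈ ends D, f h < B) (X K : ℕ) (t : Table) :
    (smoothAll B X K f D t).eval (fun _ => 1) =
      t.eval fun m => stateSum X K (D.map (Vertex.smoothings f)) (digit B m) := by
  induction D generalizing t with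
  | nil => simp [smoothAll, stateSum, choices, numLoops]
  | cons v D ih =>
    obtain ⟨hv, hD⟩ : (∀ h ∈ v.ends, f h < B) ∧ ∀ h ∈ ends D, f h < B := by
      simpa only [ends, List.flatMap_cons, List.forall_mem_append] using hD
    rw [smoothAll, v.forceSmoothings_eq, Table.seq_eq, ih hD, Table.eval_fold
      (eval_smoothInto (fun _ hs _ => Vertex.lt_of_mem_smoothings hv hs) X K _)]
    rfl

end Transfer

section Numbering

variable {L : Type}

theorem digit_ofDigits {B : ℕ} {l : List ℕ} (hl : ∀ c ∈ l, c < B) (a : ℕ) :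
    digit B (Nat.ofDigits B l) a = l.getD a 0 := by
  induction l generalizing a with
  | nil => simp [digit_eq]
  | cons c l ih =>
    rw [List.forall_mem_cons] at hl
    have hB : 0 < B := by lia
    rw [digit_eq, Nat.ofDigits_cons]
    cases a with
    | zero => simp [Nat.mod_eq_of_lt hl.1]
    | succ a =>
      rw [pow_succ', ← Nat.div_div_eq_div_mul, Nat.add_mul_div_left _ _ hB, Nat.div_eq_of_lt hl.1,
        zero_add, List.getD_cons_succ, ← ih hl.2, digit_eq]

/-- The diagram whose vertices are listed in the given order. -/
def reorder (order : List ℕ) (D : Diagram L) : Diagram L := order.filterMap (D[·]?)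

theorem reorder_perm {order : List ℕ} {D : Diagram L} (h : order.Perm (List.range D.length)) :
    (reorder order D).Perm D := by
  have hrange : (List.range D.length).filterMap (D[·]?) = D := by
    clear h
    induction D with
    | nil => rfl
    | cons v D ih =>
      rw [List.length_cons, List.range_succ_eq_map, List.filterMap_cons, List.filterMap_map]
      simpa [Function.comp_def] using ih
  exact (h.filterMap _).trans (.of_eq hrange)

/-- The number of the half-edge `h` in the list of all ends of a diagram. -/
def index [Encodable L] (D : Diagram L) (h : HalfEdge L) : ℕ :=
  ((ends D).map Encodable.encode).idxOf (Encodable.encode h)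

/-- The base in which pairings of the ends of a diagram are encoded. The number of ends is even: the
kernel hashes a big numeral by its residue modulo `2 ^ 64`, so that an even base leads to many hash
collisions. -/
def keyBase (D : Diagram L) : ℕ := (ends D).length + 1

/-- The number that encodes the pairing of the two ends of each edge. -/
def pairingKey [Encodable L] (D : Diagram L) : ℕ :=
  Nat.ofDigits (keyBase D) ((ends D).map fun h => index D h.flip)

variable [Encodable L] {D : Diagram L}

theorem index_lt_length_iff {h : HalfEdge L} : index D h < (ends D).length ↔ h ∈ ends D := by
  rw [← List.mem_map_of_injective Encodable.encode_injective, ← List.idxOf_lt_length_iff,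
    List.length_map, index]

theorem index_lt_keyBase {h : HalfEdge L} (hh : h ∈ ends D) : index D h < keyBase D :=
  Nat.lt_succ_of_lt (index_lt_length_iff.2 hh)

theorem index_inj {h h' : HalfEdge L} (hh : h ∈ ends D) : index D h = index D h' ↔ h = h' :=
  (List.idxOf_inj (List.mem_map_of_mem hh)).trans Encodable.encode_injective.eq_iff

theorem digit_pairingKey (hflip : ∀ h ∈ ends D, h.flip ∈ ends D) {h : HalfEdge L}
    (hh : h ∈ ends D) :
    digit (keyBase D) (pairingKey D) (index D h) = index D h.flip := by
  have hlt := index_lt_length_iff.2 hh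
  have hget : (ends D)[index D h] = h := by
    have hencode := List.getElem_idxOf
      (List.idxOf_lt_length_iff.2 (List.mem_map_of_mem (f := Encodable.encode) hh))
    simpa only [index, List.getElem_map, Encodable.encode_inj] using hencode
  rw [pairingKey, digit_ofDigits, List.getD_eq_getElem _ _ (by simpa using hlt), List.getElem_map,
    hget]
  intro c hc
  obtain ⟨h, hh, rfl⟩ := List.mem_map.1 hc
  exact index_lt_keyBase (hflip h hh)

theorem eval_smoothAll_eq_sum_choices (hD : (ends D).Nodup)
    (hflip : ∀ h ∈ ends D, h.flip ∈ ends D) (X K : ℕ) :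
    (smoothAll (keyBase D) X K (index D) D
      (.node (pairingKey D) 1 .leaf .leaf)).eval (fun _ => 1) =
    ((choices (D.map (Vertex.smoothings id))).map fun t => X ^ (t.1 + K * numCurves t.2)).sum := by
  classical
  have hrename : D.map (Vertex.smoothings (index D)) = (D.map (Vertex.smoothings id)).map
      fun σ => σ.map fun s => (s.1, s.2.map (Prod.map (index D) (index D))) := by
    rw [List.map_map]
    exact List.map_congr_left fun v _ => by cases v <;> rfl
  rw [eval_smoothAll fun h hh => index_lt_keyBase hh, Table.eval, Table.eval,
    stateSum, hrename, choices_map, List.map_map, one_mul, add_zero, add_zero]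
  congr 1
  refine List.map_congr_left fun t ht => ?_
  have hperm := joinedEnds_perm_ends ht
  rw [numCurves_eq_numLoops (hperm.nodup_iff.2 hD) (by simpa only [hperm.mem_iff] using hflip),
    Function.comp_apply, numLoops_map (s := ends D) (fun h hh h' _ => (index_inj hh).1) hflip
      (fun h hh => digit_pairingKey hflip hh) fun c => hperm.mem_iff.1]

end Numbering

section Digits

theorem digit_sum_pow {X : ℕ} {E : List ℕ} (hE : E.length < X) (i : ℕ) :
    digit X (E.map (X ^ ·)).sum i = E.count i := by
  induction E generalizing i with
  | nil => simp [digit_eq]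
  | cons e E ih =>
    rw [List.length_cons] at hE
    have ih := ih (by lia)
    have hput : putDigit X e (E.count e + 1) (E.map (X ^ ·)).sum = ((e :: E).map (X ^ ·)).sum := by
      rw [putDigit_eq, ih, List.map_cons, List.sum_cons]
      lia
    have hcount : E.count e + 1 < X := by have := E.count_le_length (a := e); lia
    rw [← hput, digit_putDigit hcount, Function.update_apply, List.count_cons, ih]
    rcases eq_or_ne i e with rfl | h
    · simp
    · simp [h, h.symm]

theorem sum_map_eq_sum_range_digit_smul {M : Type*} [AddCommMonoid M] {X len : ℕ} {E : List ℕ}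
    (hE : E.length < X) (hlen : (E.map (X ^ ·)).sum < X ^ len) (f : ℕ → M) :
    (E.map f).sum = ∑ i ∈ Finset.range len, digit X (E.map (X ^ ·)).sum i • f i := by
  simp only [digit_sum_pow hE]
  rw [Finset.sum_list_map_count]
  refine Finset.sum_subset (fun e he => ?_) fun e _ he => ?_
  · rw [List.mem_toFinset] at he
    rw [Finset.mem_range]
    have hpos := List.length_pos_of_mem he
    refine (Nat.pow_lt_pow_iff_right (a := X) (by lia)).1 (lt_of_le_of_lt ?_ hlen)
    exact List.le_sum_of_mem (List.mem_map_of_mem he)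
  · rw [List.count_eq_zero_of_not_mem (by simpa using he), zero_smul]

theorem sum_range_mul {M : Type*} [AddCommMonoid M] (J K : ℕ) (f : ℕ → M) :
    ∑ i ∈ Finset.range (J * K), f i =
      ∑ j ∈ Finset.range J, ∑ k ∈ Finset.range K, f (j * K + k) := by
  induction J with
  | zero => simp
  | succ J ih => rw [add_mul, one_mul, Finset.sum_range_add, ih, Finset.sum_range_succ]

end Digits

section Coefficients

variable {R : Type*} [CommRing R]

/-- The value at `x` of the polynomial with the coefficients `φ c` for `c` in a list, constant term
first. -/
def horner {β : Type*} (φ : β → R) (x : R) : List β → R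
  | [] => 0
  | c :: cs => φ c + x * horner φ x cs

/-- Add two lists of coefficients. -/
def addCoeffs : List ℤ → List ℤ → List ℤ
  | [], cs => cs
  | c :: cs, [] => c :: cs
  | c :: cs, c' :: cs' => (c + c') :: addCoeffs cs cs'

/-- `k cs`, where the kernel evaluates the coefficients before it substitutes them in `k`. -/
def forceCoeffs {S : Type*} : List ℤ → (List ℤ → S) → S
  | [], k => k []
  | .ofNat n :: cs, k => force n fun n => forceCoeffs cs fun cs => k (.ofNat n :: cs)
  | .negSucc n :: cs, k => force n fun n => forceCoeffs cs fun cs => k (.negSucc n :: cs)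

/-- The coefficients of `q ^ n * (P₀ + P₁ * d + ⋯ + Pₙ₋₁ * d ^ (n - 1))`, where the polynomials `Pⱼ`
in `q` are given by their coefficients and `q * d = -(1 + q ^ 2)`. -/
def expand : List (List ℤ) → List ℤ
  | [] => []
  | row :: rows => forceCoeffs (expand rows) fun cs =>
    addCoeffs (List.replicate (rows.length + 1) 0 ++ row)
      (addCoeffs (cs.map Neg.neg) (0 :: 0 :: cs.map Neg.neg))

theorem forceCoeffs_eq {S : Type*} (cs : List ℤ) (k : List ℤ → S) : forceCoeffs cs k = k cs := by
  induction cs generalizing k with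
  | nil => rfl
  | cons c cs ih => cases c <;> rw [forceCoeffs, force_eq, ih]

theorem map_horner {S β : Type*} [CommRing S] (f : R →+* S) (φ : β → R) (x : R) (cs : List β) :
    f (horner φ x cs) = horner (fun c => f (φ c)) (f x) cs := by
  induction cs with
  | nil => exact map_zero f
  | cons c cs ih => rw [horner, map_add, map_mul, ih, horner]

theorem horner_map_range {β : Type*} (φ : β → R) (x : R) (c : ℕ → β) (n : ℕ) :
    horner φ x ((List.range n).map c) = ∑ k ∈ Finset.range n, φ (c k) * x ^ k := by
  induction n generalizing c with
  | zero => rfl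
  | succ n ih =>
    rw [List.range_succ_eq_map, List.map_cons, List.map_map, horner, ih, Finset.sum_range_succ',
      Finset.mul_sum, add_comm, pow_zero, mul_one]
    congr 1
    exact Finset.sum_congr rfl fun k _ => by rw [pow_succ', Function.comp_apply]; ring

theorem horner_addCoeffs (x : R) (cs cs' : List ℤ) :
    horner Int.cast x (addCoeffs cs cs') = horner Int.cast x cs + horner Int.cast x cs' := by
  induction cs generalizing cs' with
  | nil => simp [addCoeffs, horner]
  | cons c cs ih =>
    cases cs' with
    | nil => simp [addCoeffs, horner]
    | cons c' cs' => simp only [addCoeffs, horner, ih, Int.cast_add]; ring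

theorem horner_map_neg (x : R) (cs : List ℤ) :
    horner Int.cast x (cs.map Neg.neg) = -horner Int.cast x cs := by
  induction cs with
  | nil => simp [horner]
  | cons c cs ih => simp only [List.map_cons, horner, ih, Int.cast_neg]; ring

theorem horner_append {β : Type*} (φ : β → R) (x : R) (cs cs' : List β) :
    horner φ x (cs ++ cs') = horner φ x cs + x ^ cs.length * horner φ x cs' := by
  induction cs with
  | nil => simp [horner]
  | cons c cs ih => simp only [List.cons_append, horner, ih, List.length_cons]; ring

theorem horner_replicate_zero (x : R) (n : ℕ) : horner Int.cast x (List.replicate n 0) = 0 := by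
  induction n with
  | zero => rfl
  | succ n ih => simp [List.replicate_succ, horner, ih]

theorem horner_expand {x d : R} (hd : x * d = -(1 + x ^ 2)) (rows : List (List ℤ)) :
    horner Int.cast x (expand rows) =
      x ^ rows.length * horner (horner Int.cast x) d rows := by
  induction rows with
  | nil => simp [expand, horner]
  | cons row rows ih =>
    simp only [expand, forceCoeffs_eq, horner_addCoeffs, horner_append, horner_replicate_zero,
      horner_map_neg, horner, ih, List.length_replicate, List.length_cons, Int.cast_zero]
    linear_combination -x ^ rows.length * horner (horner Int.cast x) d rows * hd

end Coefficients

section Evaluation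

variable {L : Type} [Encodable L]

/-- The sum of `X ^ (k + K * n)` over all choices of smoothings of `D`, where `k` is the number of
`α`-smoothings and `n` the number of closed curves. If `X` is large, the digits of this number in
base `X` tell how many choices there are for each `k` and `n`. -/
noncomputable def stateKey (K X : ℕ) (D : Diagram L) : ℕ :=
  force (keyBase D) fun B => force (pairingKey D) fun m =>
  (smoothAll B X K (index D) D (.node m 1 .leaf .leaf)).eval fun _ => 1

/-- The digits of `N` in base `X` at the positions `j * K, …, j * K + K - 1`. -/
def digitRow (K X N j : ℕ) : List ℤ := (List.range K).map fun k => digit X N (j * K + k)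

/-- Computes whether the bracket polynomial of `D` has the coefficients `cs`, up to a shift. Here
`J` is an upper bound for the numbers of closed curves, and `a` and `b` are the numbers of zeros
before and after `cs` in the result. -/
noncomputable def hasBracketCoeffs (D : Diagram L) (J a : ℕ) (cs : List ℤ) (b : ℕ) : Bool :=
  force (D.countP Vertex.isClassical + 1) fun K => force (2 ^ K + 1) fun X =>
  force (stateKey K X D) fun N => decide (N < X ^ ((J + 1) * K)) &&
    decide (addCoeffs (List.replicate J 0 ++ digitRow K X N 0)
      (expand ((List.range J).map fun j => digitRow K X N (j + 1))) =
        List.replicate a 0 ++ (cs ++ List.replicate b 0))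

variable {D : Diagram L}

theorem stateKey_eq (hD : (ends D).Nodup) (hflip : ∀ h ∈ ends D, h.flip ∈ ends D) (K X : ℕ) :
    stateKey K X D = (((choices (D.map (Vertex.smoothings id))).map fun t =>
      t.1 + K * numCurves t.2).map (X ^ ·)).sum := by
  simp only [stateKey, force_eq, eval_smoothAll_eq_sum_choices hD hflip, List.map_map,
    Function.comp_def]

open LaurentPolynomial

theorem bracket_eq_sum_digitRow (hD : (ends D).Nodup) (hflip : ∀ h ∈ ends D, h.flip ∈ ends D)
    {J K X N : ℕ} (hK : K = D.countP Vertex.isClassical + 1) (hX : X = 2 ^ K + 1)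
    (hN : N = stateKey K X D) (hlt : N < X ^ ((J + 1) * K)) :
    bracket D = T (1 - K) * (horner Int.cast (T 2) (digitRow K X N 0) +
      horner (horner Int.cast (T 2)) d ((List.range J).map fun j => digitRow K X N (j + 1))) := by
  have hmod : ∀ j, ∀ k < K, (k + K * j) % K = k ∧ (k + K * j) / K = j := fun j k hk =>
    ⟨by rw [Nat.add_mul_mod_self_left, Nat.mod_eq_of_lt hk],
      by rw [Nat.add_mul_div_left _ _ (by lia), Nat.div_eq_of_lt hk, zero_add]⟩
  have hbracket : bracket D = (((choices (D.map (Vertex.smoothings id))).map fun t =>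
      t.1 + K * numCurves t.2).map fun e =>
        T (2 * (e % K : ℕ) + (1 - K) : ℤ) * d ^ (e / K - 1)).sum := by
    rw [bracket_eq_sum_choices, List.map_map]
    refine congrArg List.sum (List.map_congr_left fun t ht => ?_)
    obtain ⟨hk, hj⟩ := hmod (numCurves t.2) t.1 (by have := fst_le_countP_of_mem_choices ht; lia)
    rw [Function.comp_apply, hk, hj, hK]
    congr 2
    push_cast
    ring
  have hlength : ((choices (D.map (Vertex.smoothings id))).map fun t =>
      t.1 + K * numCurves t.2).length < X := by
    rw [List.length_map, length_choices, hX, hK]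
    exact Nat.lt_succ_of_lt (Nat.pow_lt_pow_right one_lt_two (Nat.lt_succ_self _))
  rw [stateKey_eq hD hflip] at hN
  rw [hbracket, sum_map_eq_sum_range_digit_smul hlength (hN ▸ hlt), ← hN, sum_range_mul,
    Finset.sum_range_succ', add_comm]
  have hrow : ∀ j, ∑ k ∈ Finset.range K, digit X N (j * K + k) •
      (T (2 * ((j * K + k) % K : ℕ) + (1 - K) : ℤ) * d ^ ((j * K + k) / K - 1)) =
        T (1 - K) * (horner Int.cast (T 2) (digitRow K X N j) * d ^ (j - 1)) := by
    intro j
    rw [digitRow, horner_map_range, Finset.sum_mul, Finset.mul_sum]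
    refine Finset.sum_congr rfl fun k hk => ?_
    rw [add_comm, mul_comm j]
    obtain ⟨hk, hj⟩ := hmod j k (Finset.mem_range.1 hk)
    rw [hk, hj, T_add, mul_comm 2, T_pow, nsmul_eq_mul, Int.cast_natCast]
    ring
  simp only [hrow, horner_map_range, Nat.add_sub_cancel, ← Finset.mul_sum]
  simp [mul_add]

theorem bracket_eq_of_hasBracketCoeffs (hD : ((ends D).map Encodable.encode).Nodup)
    (hflip : ∀ h ∈ ends D, index D h.flip < (ends D).length) {order : List ℕ}
    (horder : order.Perm (List.range D.length)) {J a b : ℕ} {cs : List ℤ}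
    (h : hasBracketCoeffs (reorder order D) J a cs b = true) :
    bracket D = T (2 * a - 2 * J - D.countP Vertex.isClassical) * horner Int.cast (T 2) cs := by
  simp only [index_lt_length_iff] at hflip
  have hperm := reorder_perm horder
  have hends : (ends (reorder order D)).Perm (ends D) := hperm.flatMap_right _
  rw [← bracket_perm hperm, ← hperm.countP_eq]
  simp only [hasBracketCoeffs, force_eq, Bool.and_eq_true, decide_eq_true_eq] at h
  obtain ⟨hlt, hcoeffs⟩ := h
  set n := (reorder order D).countP Vertex.isClassical
  rw [bracket_eq_sum_digitRow (hends.nodup_iff.2 hD.of_map)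
    (by simpa only [hends.mem_iff] using hflip) rfl rfl rfl hlt]
  have hd : (T 2 * d : LaurentPolynomial ℤ) = -(1 + T 2 ^ 2) := by
    rw [d, T_pow, mul_sub, mul_neg, ← T_add, ← T_add]
    simp
    ring
  have hvalue := congrArg (horner Int.cast (T 2 : LaurentPolynomial ℤ)) hcoeffs
  simp only [horner_addCoeffs, horner_append, horner_expand hd, horner_replicate_zero,
    List.length_replicate, List.length_map, List.length_range, zero_add, mul_zero, add_zero,
    ← mul_add, T_pow] at hvalue
  rw [show (1 - (n + 1 : ℕ) : ℤ) = (-2 * J - n) + J * 2 by push_cast; ring, T_add, mul_assoc,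
    hvalue, ← mul_assoc, ← T_add]
  congr 2
  ring

end Evaluation

/-! ### The brackets of the cables -/

section Cables

/-- An encoding of the labels of a cable by tuples, to number the ends of the cable. -/
def CableLabel.toProd {L : Type} : CableLabel L → ℕ × HalfEdge L × ℕ × ℕ
  | strand e m => (0, (e, true), m, 0)
  | vertical g i j => (1, g, i, j)
  | horizontal g i j => (2, g, i, j)

theorem CableLabel.toProd_injective {L : Type} : Function.Injective (toProd (L := L)) := by
  intro x y h
  cases x <;> cases y <;> simp_all [toProd]

noncomputable instance {L : Type} [Encodable L] : Encodable (CableLabel L) :=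
  Encodable.ofInj CableLabel.toProd CableLabel.toProd_injective

end Cables

section Brackets

open LaurentPolynomial

theorem T_mul_horner_nil (n : ℤ) :
    (T n * horner Int.cast (T 2) ([] : List ℤ) : LaurentPolynomial ℤ) = 0 :=
  mul_zero _

theorem T_mul_horner_cons (n c : ℤ) (cs : List ℤ) :
    (T n * horner Int.cast (T 2) (c :: cs) : LaurentPolynomial ℤ) =
      (c : LaurentPolynomial ℤ) * T n + T (n + 2) * horner Int.cast (T 2) cs := by
  rw [T_add, horner]
  ring

theorem T_mul_horner_eq_d :
    (T (-2) * horner Int.cast (T 2) [-1, 0, -1] : LaurentPolynomial ℤ) = d := by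
  simp only [T_mul_horner_cons, T_mul_horner_nil, d, Int.reduceAdd, Int.reduceNeg, Int.cast_neg,
    Int.cast_one, Int.cast_zero]
  ring

theorem bracket_unknot : bracket unknotVertices = 1 := by
  rw [bracket_eq_of_hasBracketCoeffs (order := [0]) (J := 1) (a := 1) (b := 0) (cs := [1])
    (by decide) (by decide) (by decide) (by decide +kernel)]
  simp [horner, show unknotVertices.countP Vertex.isClassical = 0 by decide]

theorem bracket_cable_two_unknot : bracket (cable 2 unknotVertices) = d := by
  rw [bracket_eq_of_hasBracketCoeffs (order := [0, 1]) (J := 2) (a := 1) (b := 0)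
    (cs := [-1, 0, -1]) (by decide +kernel) (by decide +kernel) (by decide) (by decide +kernel)]
  exact T_mul_horner_eq_d

theorem bracket_cable_three_unknot : bracket (cable 3 unknotVertices) = d ^ 2 := by
  rw [bracket_eq_of_hasBracketCoeffs (order := [0, 1, 2]) (J := 3) (a := 1) (b := 0)
    (cs := [1, 0, 2, 0, 1]) (by decide +kernel) (by decide +kernel) (by decide)
    (by decide +kernel), ← T_mul_horner_eq_d, mul_pow, T_pow]
  refine congrArg₂ _ rfl ?_
  simp only [horner, Int.cast_neg, Int.cast_one, Int.cast_zero, Int.cast_ofNat]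
  ring

theorem bracket_km : bracket kmVertices = 1 := by
  rw [bracket_eq_of_hasBracketCoeffs (order := List.range 8) (J := 4) (a := 7) (b := 6) (cs := [1])
    (by decide +kernel) (by decide +kernel) (by decide) (by decide +kernel)]
  simp [horner, show kmVertices.countP Vertex.isClassical = 6 by decide]

theorem bracket_cable_two_km : bracket (cable 2 kmVertices) = d := by
  rw [bracket_eq_of_hasBracketCoeffs (order := List.range' 24 8 ++ List.range 24) (J := 12)
    (a := 23) (b := 22) (cs := [-1, 0, -1]) (by decide +kernel) (by decide +kernel) (by decide)
    (by decide +kernel), show (cable 2 kmVertices).countP Vertex.isClassical = 24 by decide +kernel]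
  exact T_mul_horner_eq_d

/-- An order of the vertices of the cable for which few pairings arise in the computation. -/
def smoothingOrder : List ℕ :=
  [54, 55, 56, 57, 58, 59, 60, 61, 62, 63, 64, 65, 66, 67, 68, 69, 70, 71, 13, 12, 15, 16, 32,
    35, 14, 17, 34, 31, 33, 11, 10, 30, 9, 29, 28, 27, 18, 21, 24, 8, 5, 2, 19, 22, 25, 7, 4, 1,
    0, 3, 6, 20, 26, 23, 39, 36, 42, 53, 50, 47, 52, 49, 46, 45, 48, 51, 43, 44, 37, 38, 41, 40]

/-- The coefficients of the 3-strand bracket polynomial of `Km` at the powers `A ^ k` for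
`k = -60, -58, …, 54`. -/
def bracketCoeffs : List ℤ :=
  [-1, 0, 1, 2, 5, 10, 21, 25, 26, 21, 8, -19, -69, -115, -155, -175, -172, -127, -23, 109, 244,
    366, 440, 452, 372, 207, 23, -199, -358, -486, -527, -460, -364, -187, -58, 96, 208, 250, 269,
    222, 200, 131, 71, 21, -15, -29, -54, -51, -48, -36, -28, -22, -10, -6, -2, -1, 0, 1]

theorem hasBracketCoeffs_cable_three_km :
    hasBracketCoeffs (reorder smoothingOrder (cable 3 kmVertices)) 26 23 bracketCoeffs 25 =
      true := by
  decide +kernel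

theorem bracket_cable_three_km :
    bracket (cable 3 kmVertices) = T (-60) * horner Int.cast (T 2) bracketCoeffs := by
  rw [bracket_eq_of_hasBracketCoeffs (by decide +kernel) (by decide +kernel) (by decide)
    hasBracketCoeffs_cable_three_km,
    show (cable 3 kmVertices).countP Vertex.isClassical = 54 by decide +kernel]
  rfl

theorem T_mul_horner_bracketCoeffs :
    (T (-60) * horner Int.cast (T 2) bracketCoeffs : LaurentPolynomial ℤ) =
      (-T (-60) + T (-56) + 2 * T (-54) + 5 * T (-52) + 10 * T (-50) + 21 * T (-48) +
        25 * T (-46)) +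
      (26 * T (-44) + 21 * T (-42) + 8 * T (-40) - 19 * T (-38) - 69 * T (-36) - 115 * T (-34) -
        155 * T (-32)) +
      (-175 * T (-30) - 172 * T (-28) - 127 * T (-26) - 23 * T (-24) + 109 * T (-22) +
        244 * T (-20) + 366 * T (-18)) +
      (440 * T (-16) + 452 * T (-14) + 372 * T (-12) + 207 * T (-10) + 23 * T (-8) -
        199 * T (-6) - 358 * T (-4)) +
      (-486 * T (-2) - 527 - 460 * T 2 - 364 * T 4 - 187 * T 6 - 58 * T 8 + 96 * T 10) +
      (208 * T 12 + 250 * T 14 + 269 * T 16 + 222 * T 18 + 200 * T 20 + 131 * T 22 + 71 * T 24) +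
      (21 * T 26 - 15 * T 28 - 29 * T 30 - 54 * T 32 - 51 * T 34 - 48 * T 36 - 36 * T 38) +
      (-28 * T 40 - 22 * T 42 - 10 * T 44 - 6 * T 46 - 2 * T 48 - T 50 + T 54) := by
  simp only [bracketCoeffs, T_mul_horner_cons, T_mul_horner_nil, Int.reduceAdd, Int.reduceNeg]
  simp only [Int.cast_neg, Int.cast_ofNat, Int.cast_one, Int.cast_zero, T_zero]
  ring

theorem T_mul_horner_bracketCoeffs_ne :
    (T (-60) * horner Int.cast (T 2) bracketCoeffs : LaurentPolynomial ℤ) ≠ d ^ 2 := by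
  intro h
  -- The two sides take different values at `A = 2` in `ZMod 11`.
  have heval := congrArg (eval₂ (Int.castRingHom (ZMod 11)) ⟨2, 6, rfl, rfl⟩) h
  simp only [map_mul, map_horner, map_pow, d, map_sub, map_neg, eval₂_T, map_intCast] at heval
  revert heval
  decide +kernel

end Brackets

/-! ### Colourings -/

section Colorings

variable {F : Type*} [CommRing F] {L : Type}

/-- The condition at a vertex for a labelling `w` of the ends to be a colouring. The value at an end
refers to the direction out of the vertex, so that a strand that enters with `x` and leaves with `y`
has the values `-x` and `y` at its ends. -/
def Vertex.IsColored (w : HalfEdge L → F) : Vertex L → Prop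
  | .classical a b c d => w b = w d ∧ w a + w c = -2 * w b
  | .virtual a b c d => w c = -w a ∧ w d = -w b
  | .point a b => w b = -w a

instance [DecidableEq F] (w : HalfEdge L → F) : DecidablePred (Vertex.IsColored w)
  | .classical .. => inferInstanceAs (Decidable (_ ∧ _))
  | .virtual .. => inferInstanceAs (Decidable (_ ∧ _))
  | .point .. => inferInstanceAs (Decidable (_ = _))

/-- `w` takes opposite values on the two ends of every edge. -/
def IsFlipOdd (w : HalfEdge L → F) : Prop := ∀ h, w h.flip = -w h

variable (F) in
/-- The module of colourings of a diagram by elements of `F`. -/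
def colorings (D : Diagram L) : Submodule F (HalfEdge L → F) where
  carrier := {w | IsFlipOdd w ∧ (∀ h ∉ ends D, w h = 0) ∧ ∀ v ∈ D, v.IsColored w}
  zero_mem' := ⟨fun _ => by simp, fun _ _ => rfl, fun v _ => by cases v <;> simp [Vertex.IsColored]⟩
  add_mem' := by
    rintro w₁ w₂ ⟨odd₁, zero₁, col₁⟩ ⟨odd₂, zero₂, col₂⟩
    refine ⟨fun h => ?_, fun h hh => ?_, fun v hv => ?_⟩
    · simp only [Pi.add_apply, odd₁ h, odd₂ h, neg_add]
    · simp only [Pi.add_apply, zero₁ h hh, zero₂ h hh, add_zero]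
    · have := col₁ v hv
      have := col₂ v hv
      cases v <;> simp only [Vertex.IsColored, Pi.add_apply] at * <;> grind
  smul_mem' := by
    rintro r w ⟨odd, zero, col⟩
    refine ⟨fun h => ?_, fun h hh => ?_, fun v hv => ?_⟩
    · simp only [Pi.smul_apply, odd h, smul_neg]
    · simp only [Pi.smul_apply, zero h hh, smul_zero]
    · have := col v hv
      cases v <;> simp only [Vertex.IsColored, Pi.smul_apply, smul_eq_mul] at * <;> grind

theorem Vertex.isColored_map {M : Type} (f : HalfEdge L → HalfEdge M) (w : HalfEdge M → F)
    (v : Vertex L) : (v.map f).IsColored w ↔ v.IsColored (w ∘ f) := by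
  cases v <;> rfl

theorem Vertex.ends_map {M : Type} (f : HalfEdge L → HalfEdge M) (v : Vertex L) :
    (v.map f).ends = v.ends.map f := by
  cases v <;> rfl

theorem Vertex.isColored_congr {w w' : HalfEdge L → F} {v : Vertex L}
    (h : ∀ a ∈ v.ends, w a = w' a) : v.IsColored w ↔ v.IsColored w' := by
  cases v <;> simp_all [Vertex.IsColored, Vertex.ends]

theorem colorings_perm {D D' : Diagram L} (h : D.Perm D') : colorings F D = colorings F D' := by
  ext w
  have hends : ∀ a, a ∈ ends D ↔ a ∈ ends D' := fun a => (h.flatMap_right _).mem_iff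
  simp only [colorings, Submodule.mem_mk, AddSubmonoid.mem_mk, AddSubsemigroup.mem_mk,
    Set.mem_ofPred_eq, hends, h.mem_iff]

/-- Both ends of each of the listed edges. -/
def edgeEnds (l : List L) : List (HalfEdge L) := l.flatMap fun x => [(x, true), (x, false)]

theorem mem_edgeEnds {l : List L} {h : HalfEdge L} : h ∈ edgeEnds l ↔ h.1 ∈ l := by
  obtain ⟨x, _ | _⟩ := h <;> simp [edgeEnds]

theorem nodup_of_nodup_edgeEnds {l : List L} (h : (edgeEnds l).Nodup) : l.Nodup := by
  induction l with
  | nil => exact List.nodup_nil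
  | cons x l ih =>
    simp only [edgeEnds, List.flatMap_cons, List.cons_append, List.nil_append,
      List.nodup_cons, List.mem_cons, not_or] at h
    exact List.nodup_cons.2 ⟨fun hx => h.2.1 (mem_edgeEnds.2 hx), ih h.2.2⟩

/-- A tangle `T` with boundary ends `outer` and interior edges `inner`, whose colourings are
determined by their boundary values: the values that occur on the boundary are those satisfying
`B`, and `G` computes from them the values on the interior edges. -/
structure IsTangle (T : Diagram L) (outer : List (HalfEdge L)) (inner : List L)
    (B : List F → Prop) (G : List F → List F) : Prop where
  ends_perm : (ends T).Perm (outer ++ edgeEnds inner)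
  length_eq : ∀ u, B u → (G u).length = inner.length
  isColored_iff : ∀ w, IsFlipOdd w → ((∀ v ∈ T, v.IsColored w) ↔
    B (outer.map w) ∧ (inner.map fun x => w (x, true)) = G (outer.map w))

theorem IsTangle.of_count {T : Diagram L} {outer : List (HalfEdge L)} {inner : List L}
    {B : List F → Prop} {G : List F → List F}
    (hcount : ∀ [DecidableEq L] h,
      (T.flatMap Vertex.ends).count h = outer.count h + (edgeEnds inner).count h)
    (length_eq : ∀ u, B u → (G u).length = inner.length)
    (hcol : ∀ w, inner.Forall (fun x => w (x, false) = -w (x, true)) →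
      (T.Forall (Vertex.IsColored w) ↔
        B (outer.map w) ∧ (inner.map fun x => w (x, true)) = G (outer.map w))) :
    IsTangle T outer inner B G where
  ends_perm := by
    classical exact List.perm_iff_count.2 fun h => by rw [List.count_append]; exact hcount h
  length_eq := length_eq
  isColored_iff w hw := by
    rw [← List.forall_iff_forall_mem]
    exact hcol w (List.forall_iff_forall_mem.2 fun x _ => hw (x, true))

variable (F) in
/-- Two tangles with the same ends such that the same boundary values extend to colourings. -/
def HaveSameBoundary (T T' : Diagram L) : Prop :=
  ∃ (outer : List (HalfEdge L)) (inner inner' : List L) (B : List F → Prop)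
    (G G' : List F → List F), IsTangle T outer inner B G ∧ IsTangle T' outer inner' B G'

theorem haveSameBoundary_rotateClassical (a b c d : HalfEdge L) :
    HaveSameBoundary F [.classical a b c d] [.classical c d a b] := by
  refine ⟨[a, b, c, d], [], [], fun | [a, b, c, d] => b = d ∧ a + c = -2 * b | _ => False,
    fun _ => [], fun _ => [], .of_count ?_ ?_ ?_, .of_count ?_ ?_ ?_⟩
  all_goals grind [edgeEnds, Vertex.ends, Vertex.IsColored, List.Forall]

theorem haveSameBoundary_rotateVirtual (a b c d : HalfEdge L) :
    HaveSameBoundary F [.virtual a b c d] [.virtual b c d a] := by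
  refine ⟨[a, b, c, d], [], [], fun | [a, b, c, d] => c = -a ∧ d = -b | _ => False,
    fun _ => [], fun _ => [], .of_count ?_ ?_ ?_, .of_count ?_ ?_ ?_⟩
  all_goals grind [edgeEnds, Vertex.ends, Vertex.IsColored, List.Forall]

theorem haveSameBoundary_rotatePoint (a b : HalfEdge L) :
    HaveSameBoundary F [.point a b] [.point b a] := by
  refine ⟨[a, b], [], [], fun | [a, b] => b = -a | _ => False,
    fun _ => [], fun _ => [], .of_count ?_ ?_ ?_, .of_count ?_ ?_ ?_⟩
  all_goals grind [edgeEnds, Vertex.ends, Vertex.IsColored, List.Forall]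

theorem haveSameBoundary_reidemeister1 (a b : HalfEdge L) (x : L) :
    HaveSameBoundary F [.classical (x, true) (x, false) a b] [.point a b] := by
  refine ⟨[a, b], [x], [], fun | [a, b] => b = -a | _ => False,
    fun | [a, _] => [a] | _ => [], fun _ => [],
    .of_count ?_ ?_ ?_, .of_count ?_ ?_ ?_⟩
  all_goals grind [edgeEnds, Vertex.ends, Vertex.IsColored, List.Forall]

theorem haveSameBoundary_reidemeister1' (a b : HalfEdge L) (x : L) :
    HaveSameBoundary F [.classical a (x, true) (x, false) b] [.point a b] := by
  refine ⟨[a, b], [x], [], fun | [a, b] => b = -a | _ => False,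
    fun | [a, _] => [-a] | _ => [], fun _ => [],
    .of_count ?_ ?_ ?_, .of_count ?_ ?_ ?_⟩
  all_goals grind [edgeEnds, Vertex.ends, Vertex.IsColored, List.Forall]

theorem haveSameBoundary_reidemeister2 (a b c d : HalfEdge L) (x y : L) :
    HaveSameBoundary F
      [.classical a c (x, true) (y, true), .classical (x, false) d b (y, false)]
      [.point a b, .point c d] := by
  refine ⟨[a, b, c, d], [x, y], [], fun | [a, b, c, d] => b = -a ∧ d = -c | _ => False,
    fun | [a, _, c, _] => [-a - 2 * c, c] | _ => [], fun _ => [],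
    .of_count ?_ ?_ ?_, .of_count ?_ ?_ ?_⟩
  all_goals grind [edgeEnds, Vertex.ends, Vertex.IsColored, List.Forall]

theorem haveSameBoundary_reidemeister3 (a b c d e f : HalfEdge L) (x y z : L) :
    HaveSameBoundary F
      [.classical a (y, true) (x, true) f, .classical b c (z, true) (y, false),
        .classical (x, false) (z, false) d e]
      [.classical a b (x, true) (z, true), .classical (z, false) (y, true) e f,
        .classical (x, false) c d (y, false)] := by
  refine ⟨[a, b, c, d, e, f], [x, y, z], [x, y, z],
    fun | [a, b, c, d, e, f] => f = -c ∧ e = b + 2 * c ∧ d = -a - 2 * b - 2 * c | _ => False,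
    fun | [a, b, c, _, _, _] => [-a + 2 * c, -c, -b - 2 * c] | _ => [],
    fun | [a, b, c, _, _, _] => [-a - 2 * b, -c, b] | _ => [],
    .of_count ?_ ?_ ?_, .of_count ?_ ?_ ?_⟩
  all_goals grind [edgeEnds, Vertex.ends, Vertex.IsColored, List.Forall]

theorem haveSameBoundary_reidemeister3' (a b c d e f : HalfEdge L) (x y z : L) :
    HaveSameBoundary F
      [.classical a (y, true) (x, true) f, .classical b c (z, true) (y, false),
        .classical (z, false) d e (x, false)]
      [.classical b (x, true) (z, true) a, .classical (z, false) (y, true) e f,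
        .classical (x, false) c d (y, false)] := by
  refine ⟨[a, b, c, d, e, f], [x, y, z], [x, y, z],
    fun | [a, b, c, d, e, f] => f = -c ∧ e = -b - 2 * a + 2 * c ∧ d = a - 2 * c | _ => False,
    fun | [a, b, c, _, _, _] => [-a + 2 * c, -c, -b - 2 * c] | _ => [],
    fun | [a, b, c, _, _, _] => [a, -c, -b - 2 * a] | _ => [],
    .of_count ?_ ?_ ?_, .of_count ?_ ?_ ?_⟩
  all_goals grind [edgeEnds, Vertex.ends, Vertex.IsColored, List.Forall]

theorem haveSameBoundary_virtual1 (a b : HalfEdge L) (x : L) :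
    HaveSameBoundary F [.virtual (x, true) (x, false) a b] [.point a b] := by
  refine ⟨[a, b], [x], [], fun | [a, b] => b = -a | _ => False,
    fun | [a, _] => [-a] | _ => [], fun _ => [],
    .of_count ?_ ?_ ?_, .of_count ?_ ?_ ?_⟩
  all_goals grind [edgeEnds, Vertex.ends, Vertex.IsColored, List.Forall]

theorem haveSameBoundary_virtual2 (a b c d : HalfEdge L) (x y : L) :
    HaveSameBoundary F
      [.virtual a c (x, true) (y, true), .virtual (x, false) d b (y, false)]
      [.point a b, .point c d] := by
  refine ⟨[a, b, c, d], [x, y], [], fun | [a, b, c, d] => b = -a ∧ d = -c | _ => False,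
    fun | [a, _, c, _] => [-a, -c] | _ => [], fun _ => [],
    .of_count ?_ ?_ ?_, .of_count ?_ ?_ ?_⟩
  all_goals grind [edgeEnds, Vertex.ends, Vertex.IsColored, List.Forall]

theorem haveSameBoundary_virtual3 (a b c d e f : HalfEdge L) (x y z : L) :
    HaveSameBoundary F
      [.virtual a (y, true) (x, true) f, .virtual b c (z, true) (y, false),
        .virtual (x, false) (z, false) d e]
      [.virtual a b (x, true) (z, true), .virtual (z, false) (y, true) e f,
        .virtual (x, false) c d (y, false)] := by
  refine ⟨[a, b, c, d, e, f], [x, y, z], [x, y, z],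
    fun | [a, b, c, d, e, f] => f = -c ∧ e = -b ∧ d = -a | _ => False,
    fun | [a, b, c, _, _, _] => [-a, c, -b] | _ => [],
    fun | [a, b, c, _, _, _] => [-a, c, -b] | _ => [],
    .of_count ?_ ?_ ?_, .of_count ?_ ?_ ?_⟩
  all_goals grind [edgeEnds, Vertex.ends, Vertex.IsColored, List.Forall]

theorem haveSameBoundary_virtual4 (a b c d e f : HalfEdge L) (x y z : L) :
    HaveSameBoundary F
      [.virtual a (y, true) (x, true) f, .virtual b c (z, true) (y, false),
        .classical (x, false) (z, false) d e]
      [.classical a b (x, true) (z, true), .virtual (z, false) (y, true) e f,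
        .virtual (x, false) c d (y, false)] := by
  refine ⟨[a, b, c, d, e, f], [x, y, z], [x, y, z],
    fun | [a, b, c, d, e, f] => f = -c ∧ e = b ∧ d = -a - 2 * b | _ => False,
    fun | [a, b, c, _, _, _] => [-a, c, -b] | _ => [],
    fun | [a, b, c, _, _, _] => [-a - 2 * b, c, b] | _ => [],
    .of_count ?_ ?_ ?_, .of_count ?_ ?_ ?_⟩
  all_goals grind [edgeEnds, Vertex.ends, Vertex.IsColored, List.Forall]

theorem haveSameBoundary_virtual4' (a b c d e f : HalfEdge L) (x y z : L) :
    HaveSameBoundary F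
      [.virtual a (y, true) (x, true) f, .virtual b c (z, true) (y, false),
        .classical (z, false) d e (x, false)]
      [.classical b (x, true) (z, true) a, .virtual (z, false) (y, true) e f,
        .virtual (x, false) c d (y, false)] := by
  refine ⟨[a, b, c, d, e, f], [x, y, z], [x, y, z],
    fun | [a, b, c, d, e, f] => f = -c ∧ e = -b - 2 * a ∧ d = a | _ => False,
    fun | [a, b, c, _, _, _] => [-a, c, -b] | _ => [],
    fun | [a, b, c, _, _, _] => [a, c, -b - 2 * a] | _ => [],
    .of_count ?_ ?_ ?_, .of_count ?_ ?_ ?_⟩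
  all_goals grind [edgeEnds, Vertex.ends, Vertex.IsColored, List.Forall]

theorem mem_colorings_iff {D : Diagram L} {w : HalfEdge L → F} : w ∈ colorings F D ↔
    IsFlipOdd w ∧ (∀ h ∉ ends D, w h = 0) ∧ ∀ v ∈ D, v.IsColored w :=
  Iff.rfl

theorem ends_map {M : Type} (f : HalfEdge L → HalfEdge M) (D : Diagram L) :
    ends (D.map (Vertex.map f)) = (ends D).map f := by
  simp only [ends, List.flatMap_map, List.map_flatMap, Vertex.ends_map]

theorem mem_colorings_map_iff {D : Diagram L} {f : Equiv.Perm (HalfEdge L)}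
    (hf : ∀ h, f h.flip = (f h).flip) {w : HalfEdge L → F} :
    w ∈ colorings F (D.map (Vertex.map f)) ↔ w ∘ f ∈ colorings F D := by
  simp only [mem_colorings_iff, ends_map, List.forall_mem_map, Vertex.isColored_map]
  refine and_congr ⟨fun odd h => ?_, fun odd h => ?_⟩ (and_congr ?_ Iff.rfl)
  · simpa only [Function.comp_apply, hf] using odd (f h)
  · simpa only [Function.comp_apply, hf, f.apply_symm_apply] using odd (f.symm h)
  · rw [f.surjective.forall]
    simp only [List.mem_map_of_injective f.injective, Function.comp_apply]

variable (F) in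
/-- Renaming the ends of a diagram does not change its colourings. -/
noncomputable def coloringsRename (D : Diagram L) (f : Equiv.Perm (HalfEdge L))
    (hf : ∀ h, f h.flip = (f h).flip) :
    colorings F (D.map (Vertex.map f)) ≃ₗ[F] colorings F D :=
  (LinearEquiv.funCongrLeft F F f).ofSubmodules _ _ <| by
    ext w
    rw [Submodule.mem_map_equiv, mem_colorings_map_iff hf]
    exact iff_of_eq (congrArg (· ∈ colorings F D) (funext fun h => by simp))

variable (F) in
/-- Restricting the colourings of a diagram to some of its ends. -/
def restrictColorings (D : Diagram L) (S : List (HalfEdge L)) :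
    colorings F D →ₗ[F] ({h // h ∈ S} → F) :=
  (LinearMap.funLeft F F Subtype.val).domRestrict (colorings F D)

open Classical in
/-- The labelling `w` with the values on the listed edges replaced by those of `f`. -/
noncomputable def replaceOn (l : List L) (f : L → F) (w : HalfEdge L → F) : HalfEdge L → F :=
  fun h => if h.1 ∈ l then bif h.2 then f h.1 else -f h.1 else w h

theorem replaceOn_of_mem {l : List L} {f : L → F} {w : HalfEdge L → F} {x : L} (hx : x ∈ l) :
    replaceOn l f w (x, true) = f x := by
  simp [replaceOn, hx]

theorem replaceOn_of_notMem {l : List L} {f : L → F} {w : HalfEdge L → F} {h : HalfEdge L}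
    (hh : h.1 ∉ l) : replaceOn l f w h = w h := by
  simp [replaceOn, hh]

theorem IsFlipOdd.replaceOn {w : HalfEdge L → F} (hw : IsFlipOdd w) (l : List L) (f : L → F) :
    IsFlipOdd (replaceOn l f w) := by
  rintro ⟨x, _ | _⟩ <;> by_cases hx : x ∈ l <;>
    simp [VirtualKnotTheory.replaceOn, HalfEdge.flip, hx, ← hw _]

namespace IsTangle

variable {T rest : Diagram L} {outer : List (HalfEdge L)} {inner : List L} {B : List F → Prop}
  {G : List F → List F}

theorem ends_append_perm (hT : IsTangle T outer inner B G) (rest : Diagram L) :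
    (ends (T ++ rest)).Perm (outer ++ ends rest ++ edgeEnds inner) := by
  rw [ends, List.flatMap_append]
  refine (hT.ends_perm.append_right _).trans ?_
  rw [List.append_assoc, List.append_assoc]
  exact List.perm_append_comm.append_left _

theorem mem_ends_append_iff (hT : IsTangle T outer inner B G) {h : HalfEdge L} :
    h ∈ ends (T ++ rest) ↔ h ∈ outer ++ ends rest ∨ h.1 ∈ inner := by
  rw [(hT.ends_append_perm rest).mem_iff, List.mem_append, mem_edgeEnds]

theorem fst_notMem_inner (hT : IsTangle T outer inner B G) (nodup : (ends (T ++ rest)).Nodup)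
    {h : HalfEdge L} (hh : h ∈ outer ++ ends rest) : h.1 ∉ inner := fun hx =>
  List.disjoint_of_nodup_append ((hT.ends_append_perm rest).nodup_iff.1 nodup) hh
    (mem_edgeEnds.2 hx)

theorem nodup_inner (hT : IsTangle T outer inner B G) (nodup : (ends (T ++ rest)).Nodup) :
    inner.Nodup :=
  nodup_of_nodup_edgeEnds ((hT.ends_append_perm rest).nodup_iff.1 nodup).of_append_right

theorem mem_colorings_append_iff (hT : IsTangle T outer inner B G) {w : HalfEdge L → F} :
    w ∈ colorings F (T ++ rest) ↔ IsFlipOdd w ∧ (∀ h ∉ ends (T ++ rest), w h = 0) ∧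
      B (outer.map w) ∧ (inner.map fun x => w (x, true)) = G (outer.map w) ∧
      ∀ v ∈ rest, v.IsColored w := by
  rw [mem_colorings_iff, List.forall_mem_append]
  refine and_congr_right fun odd => and_congr_right fun _ => ?_
  rw [hT.isColored_iff w odd, and_assoc]

theorem restrictColorings_injective (hT : IsTangle T outer inner B G) (rest : Diagram L) :
    Function.Injective (restrictColorings F (T ++ rest) (outer ++ ends rest)) := by
  rintro ⟨w, hw⟩ ⟨w', hw'⟩ heq
  have hS : ∀ h ∈ outer ++ ends rest, w h = w' h := fun h hh => congrFun heq ⟨h, hh⟩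
  obtain ⟨odd, zero, -, hinner, -⟩ := hT.mem_colorings_append_iff.1 hw
  obtain ⟨odd', zero', -, hinner', -⟩ := hT.mem_colorings_append_iff.1 hw'
  have houter : outer.map w = outer.map w' :=
    List.map_congr_left fun h hh => hS h (List.mem_append_left _ hh)
  have htrue : ∀ x ∈ inner, w (x, true) = w' (x, true) := by
    rwa [houter, ← hinner', List.map_inj_left] at hinner
  refine Subtype.ext (funext fun h => ?_)
  by_cases hh : h ∈ ends (T ++ rest)
  · rcases hT.mem_ends_append_iff.1 hh with hh | hx
    · exact hS h hh
    · obtain ⟨x, _ | _⟩ := h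
      · exact (odd (x, true)).trans ((congrArg _ (htrue x hx)).trans (odd' (x, true)).symm)
      · exact htrue x hx
  · exact (zero h hh).trans (zero' h hh).symm

theorem exists_extension (hT : IsTangle T outer inner B G)
    (nodup : (ends (T ++ rest)).Nodup) {w : HalfEdge L → F} (odd : IsFlipOdd w)
    (zero : ∀ h ∉ outer ++ ends rest, w h = 0) (hB : B (outer.map w))
    (col : ∀ v ∈ rest, v.IsColored w) :
    ∃ w' ∈ colorings F (T ++ rest), ∀ h ∈ outer ++ ends rest, w' h = w h := by
  classical
  set f : L → F := fun x => (G (outer.map w)).getD (inner.idxOf x) 0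
  have agree : ∀ h ∈ outer ++ ends rest, replaceOn inner f w h = w h := fun h hh =>
    replaceOn_of_notMem (hT.fst_notMem_inner nodup hh)
  have houter : outer.map (replaceOn inner f w) = outer.map w :=
    List.map_congr_left fun h hh => agree h (List.mem_append_left _ hh)
  have hinner : (inner.map fun x => replaceOn inner f w (x, true)) = G (outer.map w) := by
    refine List.ext_getElem (by simp [hT.length_eq _ hB]) fun i hi hi' => ?_
    rw [List.length_map] at hi
    rw [List.getElem_map, replaceOn_of_mem (List.getElem_mem hi)]
    simp only [f, (hT.nodup_inner nodup).idxOf_getElem i hi, List.getD_eq_getElem _ _ hi']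
  refine ⟨replaceOn inner f w, hT.mem_colorings_append_iff.2 ⟨odd.replaceOn _ _, fun h hh => ?_,
    by rwa [houter], by rw [hinner, houter], fun v hv => ?_⟩, agree⟩
  · rw [hT.mem_ends_append_iff, not_or] at hh
    rw [replaceOn_of_notMem hh.2, zero h hh.1]
  · exact (Vertex.isColored_congr fun h hh => agree h
      (List.mem_append_right _ (List.mem_flatMap.2 ⟨v, hv, hh⟩))).2 (col v hv)

theorem mem_range_restrictColorings_iff (hT : IsTangle T outer inner B G)
    (nodup : (ends (T ++ rest)).Nodup) {u : {h // h ∈ outer ++ ends rest} → F} :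
    u ∈ LinearMap.range (restrictColorings F (T ++ rest) (outer ++ ends rest)) ↔
      ∃ w, IsFlipOdd w ∧ (∀ h ∉ outer ++ ends rest, w h = 0) ∧ B (outer.map w) ∧
        (∀ v ∈ rest, v.IsColored w) ∧ w ∘ Subtype.val = u := by
  constructor
  · rintro ⟨⟨w, hw⟩, rfl⟩
    obtain ⟨odd, zero, hB, -, col⟩ := hT.mem_colorings_append_iff.1 hw
    have agree : ∀ h ∈ outer ++ ends rest, replaceOn inner 0 w h = w h := fun h hh =>
      replaceOn_of_notMem (hT.fst_notMem_inner nodup hh)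
    refine ⟨replaceOn inner 0 w, odd.replaceOn _ _, fun h hh => ?_, ?_, fun v hv => ?_,
      funext fun h => agree h h.2⟩
    · by_cases hx : h.1 ∈ inner
      · simp [replaceOn, hx]
      · rw [replaceOn_of_notMem hx, zero h (mt hT.mem_ends_append_iff.1 (not_or.2 ⟨hh, hx⟩))]
    · rwa [List.map_congr_left fun h hh => agree h (List.mem_append_left _ hh)]
    · exact (Vertex.isColored_congr fun h hh => agree h
        (List.mem_append_right _ (List.mem_flatMap.2 ⟨v, hv, hh⟩))).2 (col v hv)
  · rintro ⟨w, odd, zero, hB, col, rfl⟩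
    obtain ⟨w', hw', agree⟩ := hT.exists_extension nodup odd zero hB col
    exact ⟨⟨w', hw'⟩, funext fun h => agree h h.2⟩

end IsTangle

theorem HaveSameBoundary.nonempty_colorings_equiv {T T' rest : Diagram L}
    (hT : HaveSameBoundary F T T') (nodup : (ends (T ++ rest)).Nodup)
    (nodup' : (ends (T' ++ rest)).Nodup) :
    Nonempty (colorings F (T ++ rest) ≃ₗ[F] colorings F (T' ++ rest)) := by
  obtain ⟨outer, inner, inner', B, G, G', hT, hT'⟩ := hT
  have hrange : LinearMap.range (restrictColorings F (T ++ rest) (outer ++ ends rest)) =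
      LinearMap.range (restrictColorings F (T' ++ rest) (outer ++ ends rest)) := by
    ext u
    rw [hT.mem_range_restrictColorings_iff nodup, hT'.mem_range_restrictColorings_iff nodup']
  exact ⟨(LinearEquiv.ofInjective _ (hT.restrictColorings_injective rest)).trans
    ((LinearEquiv.ofEq _ _ hrange).trans
      (LinearEquiv.ofInjective _ (hT'.restrictColorings_injective rest)).symm)⟩

theorem ends_subdivide_perm [DecidableEq L] {v : Vertex L} {a : HalfEdge L} (x : L)
    (ha : a ∈ v.ends) (nodup : v.ends.Nodup) :
    (ends [v.map (fun h => if h = a then (x, true) else h), .point (x, false) a]).Perm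
      (v.ends ++ edgeEnds [x]) := by
  have herase : (v.ends.erase a).map (fun h => if h = a then (x, true) else h) =
      v.ends.erase a :=
    (List.map_congr_left fun h hh => if_neg (nodup.mem_erase_iff.1 hh).1).trans (List.map_id _)
  have hperm := List.perm_cons_erase ha
  have hmap : (v.ends.map fun h => if h = a then (x, true) else h).Perm
      ((x, true) :: v.ends.erase a) := by
    simpa only [List.map_cons, if_true, herase] using
      hperm.map fun h => if h = a then (x, true) else h
  simp only [ends, edgeEnds, List.flatMap_cons, List.flatMap_nil, List.append_nil,
    Vertex.ends_map]
  refine (hmap.append_right _).trans (.trans ?_ (hperm.symm.append_right _))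
  refine List.perm_iff_count.2 fun h => ?_
  simp only [Vertex.ends, List.count_append, List.count_cons, List.count_nil]
  omega

theorem haveSameBoundary_subdivide [DecidableEq L] (v : Vertex L) (a : HalfEdge L) (x : L)
    (ha : a ∈ v.ends) (nodup : v.ends.Nodup) :
    HaveSameBoundary F [v]
      [v.map (fun h => if h = a then (x, true) else h), .point (x, false) a] := by
  set label : List F → HalfEdge L → F := fun u h => u.getD (v.ends.idxOf h) 0 with hlabel
  have label_map : ∀ w : HalfEdge L → F, ∀ h ∈ v.ends, label (v.ends.map w) h = w h := by
    intro w h hh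
    simp [hlabel, List.getD_eq_getElem?_getD, List.getElem?_map, List.getElem?_idxOf hh]
  have isColored_label (w : HalfEdge L → F) :
      v.IsColored (label (v.ends.map w)) ↔ v.IsColored w :=
    Vertex.isColored_congr (label_map w)
  refine ⟨v.ends, [], [x], fun u => v.IsColored (label u), fun _ => [], fun u => [label u a],
    ⟨by simp [ends, edgeEnds], by simp, fun w _ => by simp [isColored_label]⟩,
    ⟨?_, by simp, fun w odd => ?_⟩⟩
  · exact ends_subdivide_perm x ha nodup
  · have hodd : w (x, false) = -w (x, true) := odd (x, true)
    have hxa : w (x, true) = w a → w ∘ (fun h => if h = a then (x, true) else h) = w := by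
      intro hx
      funext h
      by_cases h = a <;> simp_all
    have hpoint : Vertex.IsColored w (.point (x, false) a) ↔ w (x, true) = w a := by
      rw [Vertex.IsColored, hodd, neg_neg, eq_comm]
    simp only [List.forall_mem_cons, List.not_mem_nil, false_imp_iff, implies_true, and_true,
      Vertex.isColored_map, hpoint, List.map_cons, List.map_nil, List.cons.injEq,
      label_map w a ha, isColored_label]
    exact and_congr_left fun hx => by rw [hxa hx]

variable (F) in
theorem LocalMove.haveSameBoundary {T T' : Diagram ℕ} (h : LocalMove T T')
    (nodup : (ends T).Nodup) : HaveSameBoundary F T T' := by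
  cases h with
  | rotateClassical => exact haveSameBoundary_rotateClassical ..
  | rotateVirtual => exact haveSameBoundary_rotateVirtual ..
  | rotatePoint => exact haveSameBoundary_rotatePoint ..
  | subdivide v a x ha =>
    rw [ends, List.flatMap_singleton] at nodup
    exact haveSameBoundary_subdivide v a x ha nodup
  | reidemeister1 => exact haveSameBoundary_reidemeister1 ..
  | reidemeister1' => exact haveSameBoundary_reidemeister1' ..
  | reidemeister2 => exact haveSameBoundary_reidemeister2 ..
  | reidemeister3 => exact haveSameBoundary_reidemeister3 ..
  | reidemeister3' => exact haveSameBoundary_reidemeister3' ..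
  | virtual1 => exact haveSameBoundary_virtual1 ..
  | virtual2 => exact haveSameBoundary_virtual2 ..
  | virtual3 => exact haveSameBoundary_virtual3 ..
  | virtual4 => exact haveSameBoundary_virtual4 ..
  | virtual4' => exact haveSameBoundary_virtual4' ..

variable (F) in
theorem Step.nonempty_colorings_equiv {D D' : Diagram ℕ} (h : Step D D')
    (nodup : (ends D).Nodup) (nodup' : (ends D').Nodup) :
    Nonempty (colorings F D ≃ₗ[F] colorings F D') := by
  cases h with
  | perm h => exact ⟨.ofEq _ _ (colorings_perm h)⟩
  | rename _ f hf => exact ⟨(coloringsRename F D f hf).symm⟩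
  | move h rest =>
    refine (h.haveSameBoundary F ?_).nonempty_colorings_equiv nodup nodup'
    rw [ends, List.flatMap_append] at nodup
    exact nodup.of_append_left

variable (F) in
theorem VirtuallyEquivalent.nonempty_colorings_equiv {K K' : VirtualKnotDiagram}
    (h : VirtuallyEquivalent K K') :
    Nonempty (colorings F K.vertices ≃ₗ[F] colorings F K'.vertices) := by
  induction h with
  | rel K K' h => exact h.nonempty_colorings_equiv F K.isDiagram.nodup K'.isDiagram.nodup
  | refl K => exact ⟨.refl ..⟩
  | symm _ _ _ ih => exact ih.map .symm
  | trans _ _ _ _ _ ih₁ ih₂ =>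
    obtain ⟨e₁⟩ := ih₁
    obtain ⟨e₂⟩ := ih₂
    exact ⟨e₁.trans e₂⟩

theorem eval_colorings_unknot_injective :
    Function.Injective fun w : colorings F unknot.vertices => w.1 (0, true) := by
  rintro ⟨w, odd, zero, -⟩ ⟨w', odd', zero', -⟩ (heq : w (0, true) = w' (0, true))
  refine Subtype.ext (funext fun h => ?_)
  by_cases hh : h ∈ ends unknot.vertices
  · have hcases : h = (0, true) ∨ h = (0, false) := by
      simpa [ends, unknot, unknotVertices, Vertex.ends] using hh
    rcases hcases with rfl | rfl
    · exact heq
    · exact (odd (0, true)).trans ((congrArg _ heq).trans (odd' (0, true)).symm)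
  · exact (zero h hh).trans (zero' h hh).symm

theorem not_linearIndependent_of_equiv_colorings_unknot [Nontrivial F] {M : Type*}
    [AddCommGroup M] [Module F M] (e : M ≃ₗ[F] colorings F unknot.vertices) (v : Fin 2 → M) :
    ¬LinearIndependent F v := by
  intro hv
  let eval : colorings F unknot.vertices →ₗ[F] F :=
    (LinearMap.proj (0, true)).domRestrict (colorings F unknot.vertices)
  have hinj : Function.Injective (eval ∘ₗ e.toLinearMap) :=
    eval_colorings_unknot_injective.comp e.injective
  simpa using (hv.map' _ (LinearMap.ker_eq_bot.2 hinj)).fintype_card_le_finrank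

/-- The labelling of the ends of numbered edges with value `l[i]` at `(i, true)` and `-l[i]` at
`(i, false)`. -/
def labelling (l : List F) : HalfEdge ℕ → F := fun h =>
  bif h.2 then l.getD h.1 0 else -l.getD h.1 0

theorem labelling_mem_colorings_Km {l : List F} (hl : l.length ≤ 16)
    (hcol : ∀ v ∈ Km.vertices, v.IsColored (labelling l)) :
    labelling l ∈ colorings F Km.vertices := by
  refine ⟨?_, fun ⟨i, b⟩ hi => ?_, hcol⟩
  · rintro ⟨i, _ | _⟩ <;> simp [labelling, HalfEdge.flip]
  · have hmem : ∀ i < 16, ∀ b, (i, b) ∈ ends Km.vertices := by decide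
    have hlen : l.length ≤ i := hl.trans (not_lt.1 fun h => hi (hmem i h b))
    cases b <;> simp [labelling, List.getElem?_eq_none hlen]

theorem exists_linearIndependent_colorings_Km :
    ∃ v : Fin 2 → colorings (ZMod 3) Km.vertices, LinearIndependent (ZMod 3) v := by
  have h₁ : labelling [0, 1, 2, 2, 1, 2, 0, 2, 2, 1] ∈ colorings (ZMod 3) Km.vertices :=
    labelling_mem_colorings_Km (by decide) (by decide)
  have h₂ : labelling [0, 0, 0, 0, 0, 0, 0, 0, 0, 0, 0, 1, 1, 2, 1, 1] ∈
      colorings (ZMod 3) Km.vertices :=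
    labelling_mem_colorings_Km (by decide) (by decide)
  refine ⟨![⟨_, h₁⟩, ⟨_, h₂⟩], LinearIndependent.pair_iff.2 fun s t hst => ?_⟩
  have heval : ∀ h, s * labelling [0, 1, 2, 2, 1, 2, 0, 2, 2, 1] h +
      t * labelling [0, 0, 0, 0, 0, 0, 0, 0, 0, 0, 0, 1, 1, 2, 1, 1] h = 0 :=
    fun h => congrFun (congrArg Subtype.val hst) h
  exact ⟨by simpa [labelling] using heval (1, true), by simpa [labelling] using heval (11, true)⟩

theorem not_virtuallyEquivalent_Km_unknot : ¬VirtuallyEquivalent Km unknot := by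
  intro h
  have : Fact (Nat.Prime 3) := ⟨Nat.prime_three⟩
  obtain ⟨e⟩ := h.nonempty_colorings_equiv (ZMod 3)
  obtain ⟨v, hv⟩ := exists_linearIndependent_colorings_Km
  exact not_linearIndependent_of_equiv_colorings_unknot e v hv

end Colorings

end VirtualKnotTheory

open LaurentPolynomial in
theorem mainTheorem6 :
    (VirtualKnotTheory.Km.bracket = 1 ∧ VirtualKnotTheory.unknot.bracket = 1) ∧
    (VirtualKnotTheory.Km.bracketN 2 = VirtualKnotTheory.d ∧
      VirtualKnotTheory.unknot.bracketN 2 = VirtualKnotTheory.d) ∧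
    (VirtualKnotTheory.Km.bracketN 3 =
        (-T (-60) + T (-56) + 2 * T (-54) + 5 * T (-52) + 10 * T (-50) + 21 * T (-48) + 25 * T (-46)) +
        (26 * T (-44) + 21 * T (-42) + 8 * T (-40) - 19 * T (-38) - 69 * T (-36) - 115 * T (-34) - 155 * T (-32)) +
        (-175 * T (-30) - 172 * T (-28) - 127 * T (-26) - 23 * T (-24) + 109 * T (-22) + 244 * T (-20) + 366 * T (-18)) +
        (440 * T (-16) + 452 * T (-14) + 372 * T (-12) + 207 * T (-10) + 23 * T (-8) - 199 * T (-6) - 358 * T (-4)) +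
        (-486 * T (-2) - 527 - 460 * T 2 - 364 * T 4 - 187 * T 6 - 58 * T 8 + 96 * T 10) +
        (208 * T 12 + 250 * T 14 + 269 * T 16 + 222 * T 18 + 200 * T 20 + 131 * T 22 + 71 * T 24) +
        (21 * T 26 - 15 * T 28 - 29 * T 30 - 54 * T 32 - 51 * T 34 - 48 * T 36 - 36 * T 38) +
        (-28 * T 40 - 22 * T 42 - 10 * T 44 - 6 * T 46 - 2 * T 48 - T 50 + T 54) ∧
      VirtualKnotTheory.unknot.bracketN 3 = VirtualKnotTheory.d ^ 2 ∧
      VirtualKnotTheory.Km.bracketN 3 ≠ VirtualKnotTheory.unknot.bracketN 3) ∧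
    ¬ VirtualKnotTheory.VirtuallyEquivalent VirtualKnotTheory.Km VirtualKnotTheory.unknot := by
  open VirtualKnotTheory in
  exact ⟨⟨bracket_km, bracket_unknot⟩, ⟨bracket_cable_two_km, bracket_cable_two_unknot⟩,
    ⟨bracket_cable_three_km.trans T_mul_horner_bracketCoeffs, bracket_cable_three_unknot, fun h =>
      T_mul_horner_bracketCoeffs_ne
        (bracket_cable_three_km.symm.trans (h.trans bracket_cable_three_unknot))⟩,
    not_virtuallyEquivalent_Km_unknot⟩
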